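/- Write $[n]=\{0,\dots,n-1\}$. A \emph{flag} $\mathcal F=\{F_i\}_{i\in[n]}$ of degree $n$ is either (a) a chain of subsets $\{1\}=F_0\subset F_1\subset\dots\subset F_{n-1}=G$ of a finite abelian group $G$ of order $n$ with $|F_i|=i+1$ for all $i\in[n]$, or (b) a chain of $K$-subspaces $K=F_0\subset F_1\subset\dots\subset F_{n-1}=L$ of a field extension $L/K$ of degree $n$ with $\dim_K F_i=i+1$ for all $i\in[n]$. Its \emph{flag type} is the function $T_{\mathcal F}\colon[n]\times[n]\to[n]$, $T_{\mathcal F}(i,j)=\min\{k\in[n] : F_iF_j\subseteq F_k\}$. The distinct subgroups of $G$ (respectively, subfields of $L/K$) generated by the sets $F_i$ form a tower $\{1\}=G_0\subset G_1\subset\dots\subset G_t=G$ (respectively, $K=L_0\subset L_1\subset\dots\subset L_t=L$), and the \emph{tower type} of $\mathcal F$ is the tuple of the numbers $|G_s|/|G_{s-1}|$ (respectively, $[L_s:L_{s-1}]$), $1\le s\le t$. For a function $T\colon[n]\times[n]\to[n]$ let $P_T$ be the set of all $(x_1,\dots,x_{n-1})\in\mathbb R^{n-1}$ such that $0\le x_1\le\dots\le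 x_{n-1}$ and $x_{T(i,j)}\le x_i+x_j$ for all $1\le i,j<n$. Let $\mathfrak T=(n_1,\dots,n_t)$ be a tower type, that is, $t\ge1$ and $n_1,\dots,n_t$ are integers $>1$, and let $n=n_1\cdots n_t$. Let $e_s$ be a generator of the $s$-th factor of $C_{n_1}\times\dots\times C_{n_t}$, where $C_m$ is the cyclic group of order $m$. For $i\in[n]$ write $i=i_1+i_2n_1+i_3(n_1n_2)+\dots+i_t(n_1\cdots n_{t-1})$ with $0\le i_s<n_s$ and put $v_i=e_1^{i_1}\cdots e_t^{i_t}$. Let $T(\mathfrak T)$ be the flag type of the flag with $F_i=\{v_0,\dots,v_i\}$, and let $\mathrm{Len}(\mathfrak T)=P_{T(\mathfrak T)}$. \textbf{Corollary.} Suppose that at least one of the following holds: (1) $n<8$; (2) $n=8$ and $\mathfrak T\ne(8)$; (3) $n$ is prime; (4) $\mathfrak T=(p,\dots,p)$ for a prime $p$; (5) $\mathfrak T=(2,p)$ for a prime $p$; (6) $\mathfrak T=(3,p)$ for a prime $p$. Then \[ \bigcup_{\mathcal F}P_{T_{\mathcal F}}=\mathrm{Len}(\mathfrak T), \] where $\mathcal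 F$ ranges over all flags (of finite abelian groups and of field extensions) of tower type $\mathfrak T$. -/

import Mathlib

open scoped Pointwise

universe u v w

/-- A tower type: a tuple `(n₁, …, n_t)` of integers `> 1`, with `t ≥ 1`. -/
structure TowerType where
  length : ℕ
  length_pos : 1 ≤ length
  entry : Fin length → ℕ
  one_lt : ∀ s, 1 < entry s

namespace TowerType

/-- The degree `n = n₁ ⋯ n_t`. -/
def degree (𝔗 : TowerType) : ℕ := ∏ s, 𝔗.entry s

/-- The tuple `(n₁, …, n_t)` as a list. -/
def toList (𝔗 : TowerType) : List ℕ := List.ofFn 𝔗.entry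

instance (𝔗 : TowerType) (s : Fin 𝔗.length) : NeZero (𝔗.entry s) :=
  ⟨(lt_trans Nat.zero_lt_one (𝔗.one_lt s)).ne'⟩

/-- The mixed radix digits of `i`: if `i_s = 𝔗.digit i s`, then `0 ≤ i_s < n_s` and
`i = i₁ + i₂ n₁ + i₃ (n₁ n₂) + ⋯ + i_t (n₁ ⋯ n_{t-1})`. -/
def digit (𝔗 : TowerType) (i : Fin 𝔗.degree) (s : Fin 𝔗.length) : ℕ :=
  (i : ℕ) / (∏ r : Fin (s : ℕ), 𝔗.entry (Fin.castLE s.is_lt.le r)) % 𝔗.entry s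

end TowerType

/-- For `p` satisfied by some index, the least `k ∈ {0, …, n-1}` with `p k`. -/
noncomputable def leastIndex {n : ℕ} (p : Fin n → Prop) (h : ∃ k, p k) : Fin n :=
  wellFounded_lt.min {k | p k} h

/-- A flag `{1} = F₀ ⊂ F₁ ⊂ ⋯ ⊂ F_{n-1} = G` of a finite abelian group `G` of cardinality `n`:
subsets of `G` with `|F_i| = i + 1`. -/
structure GroupFlag (G : Type*) [CommGroup G] [Finite G] (n : ℕ) where
  toSet : Fin n → Set G
  card_group : Nat.card G = n
  strictMono : StrictMono toSet
  card_toSet : ∀ i, (toSet i).ncard = (i : ℕ) + 1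
  first : ∀ i : Fin n, (i : ℕ) = 0 → toSet i = {1}
  last : ∀ i : Fin n, (i : ℕ) + 1 = n → toSet i = Set.univ

namespace GroupFlag

variable {G : Type*} [CommGroup G] [Finite G] {n : ℕ}

theorem exists_mul_subset (F : GroupFlag G n) (i j : Fin n) :
    ∃ k, F.toSet i * F.toSet j ⊆ F.toSet k := by
  have hn : n - 1 < n := by have := i.2; omega
  exact ⟨⟨n - 1, hn⟩, by rw [F.last ⟨n - 1, hn⟩ (by simp; omega)]; exact Set.subset_univ _⟩

/-- The flag type `T_F(i,j) = min {k ∣ F_i F_j ⊆ F_k}`. -/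
noncomputable def flagType (F : GroupFlag G n) (i j : Fin n) : Fin n :=
  leastIndex (fun k => F.toSet i * F.toSet j ⊆ F.toSet k) (F.exists_mul_subset i j)

/-- `F` has tower type `(n₁, …, n_t)`: the subgroups generated by the members of `F` are
exactly the members of a chain `{1} = G₀ ⊂ ⋯ ⊂ G_t = G`, and `|G_s| / |G_{s-1}| = n_s`. -/
def HasTowerType (F : GroupFlag G n) (𝔗 : TowerType) : Prop :=
  ∃ H : Fin (𝔗.length + 1) → Subgroup G,
    StrictMono H ∧ H 0 = ⊥ ∧ H (Fin.last 𝔗.length) = ⊤ ∧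
    (∀ A : Subgroup G, (∃ s, H s = A) ↔ ∃ i, Subgroup.closure (F.toSet i) = A) ∧
    ∀ s : Fin 𝔗.length, Nat.card (H s.succ) = 𝔗.entry s * Nat.card (H s.castSucc)

end GroupFlag

/-- A flag `K = F₀ ⊂ F₁ ⊂ ⋯ ⊂ F_{n-1} = L` of a field extension `L/K` of degree `n`:
`K`-subspaces of `L` with `dim_K F_i = i + 1`. -/
structure FieldFlag (K L : Type*) [Field K] [Field L] [Algebra K L] [FiniteDimensional K L]
    (n : ℕ) where
  toSubmodule : Fin n → Submodule K L
  finrank_field : Module.finrank K L = n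
  strictMono : StrictMono toSubmodule
  finrank_toSubmodule : ∀ i, Module.finrank K (toSubmodule i) = (i : ℕ) + 1
  /-- `1 : Submodule K L` is the image of `K` in `L`. -/
  first : ∀ i : Fin n, (i : ℕ) = 0 → toSubmodule i = 1
  last : ∀ i : Fin n, (i : ℕ) + 1 = n → toSubmodule i = ⊤

namespace FieldFlag

variable {K L : Type*} [Field K] [Field L] [Algebra K L] [FiniteDimensional K L] {n : ℕ}

theorem exists_mul_le (F : FieldFlag K L n) (i j : Fin n) :
    ∃ k, F.toSubmodule i * F.toSubmodule j ≤ F.toSubmodule k := by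
  have hn : n - 1 < n := by have := i.2; omega
  exact ⟨⟨n - 1, hn⟩, by rw [F.last ⟨n - 1, hn⟩ (by simp; omega)]; exact le_top⟩

/-- The flag type `T_F(i,j) = min {k ∣ F_i F_j ⊆ F_k}`. -/
noncomputable def flagType (F : FieldFlag K L n) (i j : Fin n) : Fin n :=
  leastIndex (fun k => F.toSubmodule i * F.toSubmodule j ≤ F.toSubmodule k) (F.exists_mul_le i j)

/-- `F` has tower type `(n₁, …, n_t)`: the subfields generated over `K` by the members of `F` are
exactly the members of a chain `K = L₀ ⊂ ⋯ ⊂ L_t = L`, and `[L_s : L_{s-1}] = n_s`. -/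
def HasTowerType (F : FieldFlag K L n) (𝔗 : TowerType) : Prop :=
  ∃ E : Fin (𝔗.length + 1) → IntermediateField K L,
    StrictMono E ∧ E 0 = ⊥ ∧ E (Fin.last 𝔗.length) = ⊤ ∧
    (∀ A : IntermediateField K L, (∃ s, E s = A) ↔
      ∃ i, IntermediateField.adjoin K (F.toSubmodule i : Set L) = A) ∧
    ∀ s : Fin 𝔗.length, IntermediateField.relfinrank (E s.castSucc) (E s.succ) = 𝔗.entry s

end FieldFlag

namespace TowerType

/-- The group `C_{n₁} × ⋯ × C_{n_t}`. -/
abbrev CyclicProd (𝔗 : TowerType) : Type := ∀ s : Fin 𝔗.length, Multiplicative (ZMod (𝔗.entry s))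

/-- The generator `e_s` of the `s`-th factor. -/
def gen (𝔗 : TowerType) (s : Fin 𝔗.length) : 𝔗.CyclicProd :=
  Pi.mulSingle s (Multiplicative.ofAdd 1)

/-- The element `v_i = e₁^{i₁} ⋯ e_t^{i_t}`. -/
def elt (𝔗 : TowerType) (i : Fin 𝔗.degree) : 𝔗.CyclicProd :=
  ∏ s, 𝔗.gen s ^ 𝔗.digit i s

theorem elt_apply (𝔗 : TowerType) (i : Fin 𝔗.degree) (s : Fin 𝔗.length) :
    𝔗.elt i s = Multiplicative.ofAdd ((𝔗.digit i s : ℕ) : ZMod (𝔗.entry s)) := by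
  rw [elt, Finset.prod_apply, Finset.prod_eq_single s]
  · rw [Pi.pow_apply, gen, Pi.mulSingle_eq_same, ← ofAdd_nsmul, nsmul_one]
  · intro r _ hr
    rw [Pi.pow_apply, gen, Pi.mulSingle_eq_of_ne hr.symm, one_pow]
  · simp

theorem elt_injective (𝔗 : TowerType) : Function.Injective 𝔗.elt := by
  intro i j h
  apply finPiFinEquiv.symm.injective
  funext s
  have hs := congrFun h s
  rw [elt_apply, elt_apply] at hs
  have hs' := (ZMod.natCast_eq_natCast_iff' _ _ _).1 (Multiplicative.ofAdd.injective hs)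
  rw [digit, digit, Nat.mod_mod, Nat.mod_mod] at hs'
  exact Fin.ext hs'

theorem card_group (𝔗 : TowerType) : Nat.card 𝔗.CyclicProd = 𝔗.degree := by
  rw [Nat.card_pi, degree]
  exact Finset.prod_congr rfl fun s _ => Nat.card_zmod (𝔗.entry s)

/-- The flag with `F_i = {v_0, …, v_i}`. -/
def flag (𝔗 : TowerType) : GroupFlag 𝔗.CyclicProd 𝔗.degree where
  toSet i := 𝔗.elt '' Set.Iic i
  card_group := 𝔗.card_group
  strictMono := fun i j hij =>
    𝔗.elt_injective.image_strictMono (Set.Iic_ssubset_Iic.2 hij)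
  card_toSet i := by
    rw [Set.ncard_image_of_injective _ 𝔗.elt_injective, ← Finset.coe_Iic, Set.ncard_coe_finset,
      Fin.card_Iic]
  first i hi := by
    have h1 : Set.Iic i = {i} := by
      ext j
      simp only [Set.mem_Iic, Set.mem_singleton_iff, Fin.le_def, Fin.ext_iff]
      omega
    rw [h1, Set.image_singleton]
    congr 1
    funext s
    rw [elt_apply, digit, hi]
    simp
  last i hi := by
    have h1 : Set.Iic i = Set.univ := by
      ext j
      have := j.2
      simp only [Set.mem_Iic, Set.mem_univ, Fin.le_def, iff_true]
      omega
    rw [h1, Set.image_univ]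
    refine Function.Surjective.range_eq ?_
    refine (Nat.bijective_iff_injective_and_card 𝔗.elt).2 ⟨𝔗.elt_injective, ?_⟩ |>.2
    rw [𝔗.card_group, Nat.card_fin]

/-- The flag type `T(𝔗)`. -/
noncomputable def flagType (𝔗 : TowerType) : Fin 𝔗.degree → Fin 𝔗.degree → Fin 𝔗.degree :=
  𝔗.flag.flagType

end TowerType

/-- The polyhedron `P_T ⊆ ℝ^{n-1}` of all `(x₁, …, x_{n-1})` such that `0 ≤ x₁ ≤ ⋯ ≤ x_{n-1}` and
`x_{T(i,j)} ≤ x_i + x_j` for `1 ≤ i, j < n`.  The coordinate `x_{a+1}` is `x a` for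
`a : Fin (n - 1)`, so that `i = a + 1`, `j = b + 1` and `T(i,j) = c + 1` below.
(For a flag type, `T(i,j) ≥ i ≥ 1`, so such a `c` always exists.) -/
def polyhedron {n : ℕ} (T : Fin n → Fin n → Fin n) : Set (Fin (n - 1) → ℝ) :=
  {x | (∀ a, 0 ≤ x a) ∧ Monotone x ∧
    ∀ (a b c : Fin (n - 1)) (i j : Fin n), (i : ℕ) = a + 1 → (j : ℕ) = b + 1 →
      (T i j : ℕ) = c + 1 → x c ≤ x a + x b}

/-- The polyhedron `Len(𝔗) = P_{T(𝔗)}`. -/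
def Len (𝔗 : TowerType) : Set (Fin (𝔗.degree - 1) → ℝ) := polyhedron 𝔗.flagType

/-! The inclusion of `Len 𝔗` in the union holds because the standard flag of the product of cyclic
groups has tower type 𝔗. For the converse, write addition in the mixed radix system with digits
bounded by n₁, …, n_t. The standard flag type satisfies T(𝔗)(i,j) ≤ a + b for some a ≤ i, b ≤ j that
add without carry (`exists_noCarry`). So it suffices that every flag satisfies T(i,j) ≥ i + j
whenever i, j ≥ 1 add without carry (`polyhedron_subset_Len`).

Flags of groups reduce to flags of fields: every finite abelian group G grades some extension L/K by
lines x_g K, and spans of the x_g turn a flag of G into a flag of L/K with the same flag type and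
tower type (`exists_graded_field`).

For a flag of fields, T(i,j) < i + j makes F_i F_j smaller than dim F_i + dim F_j - 1. Kneser's
theorem for field extensions (`exists_finrank_add_le`) then gives an intermediate field H of degree
m over K with i mod m + j mod m ≥ m, so m divides n but is not a partial product n₁⋯n_s. Moreover,
if F_i or F_j lies in H, then so does the tower field that it generates. In each listed case an
enumeration of the divisors of n leaves no such m (`not_defect`).

Kneser's theorem is proved without a separability assumption. Fix S and consider the submodular
boundary dim XS - dim X. The common stabilisers of the saturated X of boundary < μ form a decreasing
chain of fields starting at L. By induction on μ ≤ dim S - 2, whenever the chain drops after μ the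
new field has boundary exactly μ (`isRegular`). The base field has boundary dim S - 1, so it has not
been reached at μ = dim S - 1, and a product of deficient dimension is stable under a larger field.
-/

set_option linter.unusedSectionVars false

/-! ### Stable and saturated subspaces, the boundary, and duality -/

namespace LinearKneser

open Module

section

variable {F : Type u} {L : Type v} [Field F] [Field L] [Algebra F L]

/-- An intermediate field regarded as a subspace. -/
def fieldSpace (E : IntermediateField F L) : Submodule F L :=
  Subalgebra.toSubmodule E.toSubalgebra

@[simp] theorem mem_fieldSpace {E : IntermediateField F L} {x : L} : x ∈ fieldSpace E ↔ x ∈ E :=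
  Iff.rfl

theorem one_mem_fieldSpace (E : IntermediateField F L) : (1 : L) ∈ fieldSpace E := one_mem E

theorem fieldSpace_le {E E' : IntermediateField F L} : fieldSpace E ≤ fieldSpace E' ↔ E ≤ E' :=
  Iff.rfl

theorem fieldSpace_injective :
    Function.Injective (fieldSpace : IntermediateField F L → Submodule F L) := fun _ _ h =>
  le_antisymm (fieldSpace_le.1 h.le) (fieldSpace_le.1 h.ge)

/-- `X` is a vector space over the subfield `E`. -/
def IsStable (E : IntermediateField F L) (X : Submodule F L) : Prop :=
  ∀ e ∈ E, ∀ x ∈ X, e * x ∈ X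

theorem IsStable.mono {E E' : IntermediateField F L} {X : Submodule F L} (h : IsStable E X)
    (hE : E' ≤ E) : IsStable E' X := fun e he => h e (hE he)

theorem IsStable.le {E : IntermediateField F L} {X : Submodule F L} (h : IsStable E X)
    (h1 : (1 : L) ∈ X) : fieldSpace E ≤ X := fun e he => by simpa using h e he 1 h1

theorem isStable_fieldSpace (E : IntermediateField F L) : IsStable E (fieldSpace E) :=
  fun _ he _ hx => E.mul_mem he hx

theorem IsStable.mul_right {E : IntermediateField F L} {X : Submodule F L} (h : IsStable E X)
    (S : Submodule F L) : IsStable E (X * S) := by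
  intro e he x hx
  refine Submodule.mul_induction_on hx (fun a ha b hb => ?_) (fun a b ha hb => ?_)
  · rw [← mul_assoc]; exact Submodule.mul_mem_mul (h e he a ha) hb
  · rw [mul_add]; exact add_mem ha hb

theorem IsStable.sup {E : IntermediateField F L} {X Y : Submodule F L} (hX : IsStable E X)
    (hY : IsStable E Y) : IsStable E (X ⊔ Y) := by
  intro e he x hx
  obtain ⟨a, ha, b, hb, rfl⟩ := Submodule.mem_sup.1 hx
  rw [mul_add]
  exact Submodule.add_mem_sup (hX e he a ha) (hY e he b hb)

theorem IsStable.fieldSpace_mul {E : IntermediateField F L} {X : Submodule F L}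
    (h : IsStable E X) : fieldSpace E * X = X := by
  refine le_antisymm (Submodule.mul_le.2 h) fun x hx => ?_
  simpa using Submodule.mul_mem_mul (one_mem_fieldSpace E) hx

/-- The dilate `y X`. -/
def dilate (y : L) (X : Submodule F L) : Submodule F L := Submodule.span F {y} * X

theorem mem_dilate {y x : L} {X : Submodule F L} : x ∈ dilate y X ↔ ∃ z ∈ X, y * z = x :=
  Submodule.mem_span_singleton_mul

theorem mul_mem_dilate {y x : L} {X : Submodule F L} (hx : x ∈ X) : y * x ∈ dilate y X :=
  mem_dilate.2 ⟨x, hx, rfl⟩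

theorem dilate_mul (y : L) (X S : Submodule F L) : dilate y X * S = dilate y (X * S) :=
  mul_assoc _ _ _

theorem dilate_dilate (y z : L) (X : Submodule F L) : dilate y (dilate z X) = dilate (y * z) X := by
  rw [dilate, dilate, dilate, ← mul_assoc, Submodule.span_mul_span, Set.singleton_mul_singleton]

theorem dilate_one (X : Submodule F L) : dilate 1 X = X := by
  ext x; simp [mem_dilate]

theorem dilate_mono (y : L) {X Y : Submodule F L} (h : X ≤ Y) : dilate y X ≤ dilate y Y :=
  mul_le_mul' le_rfl h

theorem dilate_inv_dilate {y : L} (hy : y ≠ 0) (X : Submodule F L) :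
    dilate y⁻¹ (dilate y X) = X := by
  rw [dilate_dilate, inv_mul_cancel₀ hy, dilate_one]

theorem IsStable.dilate {E : IntermediateField F L} {X : Submodule F L} (h : IsStable E X)
    (y : L) : IsStable E (dilate y X) := by
  intro e he x hx
  obtain ⟨z, hz, rfl⟩ := mem_dilate.1 hx
  exact mem_dilate.2 ⟨e * z, h e he z hz, by ring⟩

theorem isStable_dilate_iff {E : IntermediateField F L} {X : Submodule F L} {y : L} (hy : y ≠ 0) :
    IsStable E (LinearKneser.dilate y X) ↔ IsStable E X :=
  ⟨fun h => by simpa [dilate_inv_dilate hy] using h.dilate y⁻¹, fun h => h.dilate y⟩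

/-- The largest `Y` with `Y S = X S`. -/
def sat (S X : Submodule F L) : Submodule F L := X * S / S

theorem mem_sat {S X : Submodule F L} {x : L} : x ∈ sat S X ↔ ∀ s ∈ S, x * s ∈ X * S :=
  Submodule.mem_div_iff_forall_mul_mem

theorem le_sat (S X : Submodule F L) : X ≤ sat S X := Submodule.le_div_iff_mul_le.2 le_rfl

theorem sat_mul (S X : Submodule F L) : sat S X * S = X * S :=
  le_antisymm (Submodule.le_div_iff_mul_le.1 le_rfl) (mul_le_mul' (le_sat S X) le_rfl)

theorem sat_mono (S : Submodule F L) {X Y : Submodule F L} (h : X ≤ Y) : sat S X ≤ sat S Y := by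
  refine Submodule.le_div_iff_mul_le.2 ?_
  rw [sat_mul]
  exact mul_le_mul' h le_rfl

theorem sat_sat (S X : Submodule F L) : sat S (sat S X) = sat S X := by
  rw [sat, sat_mul, ← sat]

/-- `X` is the largest `Y` with `Y S = X S`. -/
def IsSat (S X : Submodule F L) : Prop := sat S X ≤ X

theorem IsSat.sat_le {S X Y : Submodule F L} (h : IsSat S X) (hY : Y ≤ X) : sat S Y ≤ X :=
  (sat_mono S hY).trans h

theorem isSat_sat (S X : Submodule F L) : IsSat S (sat S X) := (sat_sat S X).le

theorem IsSat.dilate {S X : Submodule F L} (h : IsSat S X) {y : L} (hy : y ≠ 0) :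
    IsSat S (dilate y X) := by
  intro x hx
  refine mem_dilate.2 ⟨y⁻¹ * x, h (mem_sat.2 fun s hs => ?_), by field_simp⟩
  have := mem_sat.1 hx s hs
  rw [dilate_mul] at this
  obtain ⟨z, hz, hzx⟩ := mem_dilate.1 this
  rw [mul_assoc, ← hzx, ← mul_assoc, inv_mul_cancel₀ hy, one_mul]
  exact hz

/-- If e stabilises X S, then each e x still multiplies S into X S, so maximality of X puts e x in
X. -/
theorem IsSat.isStable {S X : Submodule F L} (h : IsSat S X) {E : IntermediateField F L}
    (hE : IsStable E (X * S)) : IsStable E X := by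
  intro e he x hx
  refine h (mem_sat.2 fun s hs => ?_)
  rw [mul_assoc]
  exact hE e he _ (Submodule.mul_mem_mul hx hs)

theorem exists_functional (F : Type u) (L : Type v) [Field F] [Field L] [Algebra F L] :
    ∃ τ : L →ₗ[F] F, τ ≠ 0 := by
  obtain ⟨f, hf⟩ := Module.Projective.exists_dual_eq_one F (one_ne_zero : (1 : L) ≠ 0)
  exact ⟨f, fun h => by simp [h] at hf⟩

/-- The nondegenerate bilinear form `(x, y) ↦ τ (x y)`. -/
def mulForm (τ : L →ₗ[F] F) : LinearMap.BilinForm F L :=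
  (LinearMap.mul F L).compr₂ τ

theorem mulForm_apply (τ : L →ₗ[F] F) (x y : L) : mulForm τ x y = τ (x * y) := rfl

/-- The orthogonal complement with respect to `(x, y) ↦ τ (x y)`. -/
def orth (τ : L →ₗ[F] F) (A : Submodule F L) : Submodule F L := (mulForm τ).orthogonal A

theorem finrank_dilate {y : L} (hy : y ≠ 0) (X : Submodule F L) :
    finrank F (dilate y X) = finrank F X := by
  have : dilate y X = X.map (LinearMap.mulLeft F y) := by
    ext x; simp [mem_dilate]
  rw [this]
  exact (Submodule.equivMapOfInjective _ (mul_right_injective₀ hy) X).finrank_eq.symm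

section FiniteDim

variable [FiniteDimensional F L]

/-- The boundary `dim XS - dim X`. -/
noncomputable def bd (S X : Submodule F L) : ℤ := (finrank F ↥(X * S) : ℤ) - finrank F X

theorem bd_dilate (S X : Submodule F L) {y : L} (hy : y ≠ 0) : bd S (dilate y X) = bd S X := by
  rw [bd, bd, dilate_mul, finrank_dilate hy, finrank_dilate hy]

theorem bd_sat_le (S X : Submodule F L) : bd S (sat S X) ≤ bd S X := by
  rw [bd, bd, sat_mul]
  have := Submodule.finrank_mono (le_sat S X)
  omega

/-- Submodularity: products distribute over sums, whereas (X ⊓ Y) S is only contained in X S ⊓ Y S.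
All later uncrossing arguments rest on this. -/
theorem bd_inf_add_bd_sup (S X Y : Submodule F L) :
    bd S (X ⊓ Y) + bd S (X ⊔ Y) ≤ bd S X + bd S Y := by
  have h1 := Submodule.finrank_sup_add_finrank_inf_eq X Y
  have h2 := Submodule.finrank_sup_add_finrank_inf_eq (X * S) (Y * S)
  have h3 : finrank F ↥((X ⊓ Y) * S) ≤ finrank F ↥(X * S ⊓ Y * S) :=
    Submodule.finrank_mono (le_inf (mul_le_mul' inf_le_left le_rfl)
      (mul_le_mul' inf_le_right le_rfl))
  rw [← Submodule.sup_mul] at h2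
  simp only [bd]
  omega

theorem bd_nonneg {S : Submodule F L} (hS : S ≠ ⊥) (X : Submodule F L) : 0 ≤ bd S X := by
  obtain ⟨s, hs, hs0⟩ := Submodule.exists_mem_ne_zero_of_ne_bot hS
  have : finrank F (dilate s X) ≤ finrank F ↥(X * S) := by
    refine Submodule.finrank_mono fun x hx => ?_
    obtain ⟨z, hz, rfl⟩ := mem_dilate.1 hx
    rw [mul_comm s z]
    exact Submodule.mul_mem_mul hz hs
  rw [finrank_dilate hs0] at this
  rw [bd]; omega

/-- The subfield of all elements stabilising every member of a family of subspaces. -/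
def commonStabilizer (𝓧 : Set (Submodule F L)) : IntermediateField F L where
  carrier := {h | ∀ X ∈ 𝓧, ∀ x ∈ X, h * x ∈ X}
  mul_mem' := fun {a b} ha hb X hX x hx => by
    rw [mul_assoc]; exact ha X hX _ (hb X hX x hx)
  add_mem' := fun {a b} ha hb X hX x hx => by
    rw [add_mul]; exact add_mem (ha X hX x hx) (hb X hX x hx)
  algebraMap_mem' := fun r X _ x hx => by
    rw [← Algebra.smul_def]; exact X.smul_mem r hx
  inv_mem' := fun a ha X hX x hx => by
    rcases eq_or_ne a 0 with rfl | h0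
    · simp
    -- Multiplication by a ≠ 0 preserves dimension, so a X ≤ X forces a X = X, and a⁻¹ also
    -- stabilises X.
    have hle : dilate a X ≤ X := fun z hz => by
      obtain ⟨w, hw, rfl⟩ := mem_dilate.1 hz
      exact ha X hX w hw
    have heq := Submodule.eq_of_le_of_finrank_eq hle (finrank_dilate h0 X)
    rw [← heq] at hx
    obtain ⟨w, hw, rfl⟩ := mem_dilate.1 hx
    rwa [← mul_assoc, inv_mul_cancel₀ h0, one_mul]

theorem isStable_commonStabilizer {𝓧 : Set (Submodule F L)} {X : Submodule F L} (hX : X ∈ 𝓧) :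
    IsStable (commonStabilizer 𝓧) X := fun _ he => he X hX

theorem le_commonStabilizer {𝓧 : Set (Submodule F L)} {E : IntermediateField F L}
    (h : ∀ X ∈ 𝓧, IsStable E X) : E ≤ commonStabilizer 𝓧 := fun e he X hX => h X hX e he

end FiniteDim

theorem mulForm_isRefl (τ : L →ₗ[F] F) : (mulForm τ).IsRefl := fun x y h => by
  rwa [mulForm_apply, mul_comm]

theorem mulForm_nondegenerate {τ : L →ₗ[F] F} (hτ : τ ≠ 0) : (mulForm τ).Nondegenerate := by
  refine (mulForm_isRefl τ).nondegenerate_iff_separatingLeft.2 fun m hm => ?_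
  by_contra h0
  refine hτ (LinearMap.ext fun x => ?_)
  have := hm (m⁻¹ * x)
  rwa [mulForm_apply, ← mul_assoc, mul_inv_cancel₀ h0, one_mul] at this

section FiniteDimOrth

variable [FiniteDimensional F L]

theorem finrank_orth_add {τ : L →ₗ[F] F} (hτ : τ ≠ 0) (A : Submodule F L) :
    finrank F (orth τ A) + finrank F A = finrank F L := by
  rw [orth, LinearMap.BilinForm.finrank_orthogonal (mulForm_nondegenerate hτ)]
  have := Submodule.finrank_le A
  omega

theorem orth_orth {τ : L →ₗ[F] F} (hτ : τ ≠ 0) (A : Submodule F L) : orth τ (orth τ A) = A :=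
  LinearMap.BilinForm.orthogonal_orthogonal (mulForm_nondegenerate hτ) (mulForm_isRefl τ) A

end FiniteDimOrth

theorem orth_anti {τ : L →ₗ[F] F} {A B : Submodule F L} (h : A ≤ B) : orth τ B ≤ orth τ A :=
  LinearMap.BilinForm.orthogonal_le h

theorem IsStable.orth {τ : L →ₗ[F] F} {E : IntermediateField F L} {A : Submodule F L}
    (h : IsStable E A) : IsStable E (orth τ A) := by
  intro e he x hx a ha
  have := hx (e * a) (h e he a ha)
  rwa [mulForm_apply, mul_comm e a, mul_assoc] at this

/-- A subspace orthogonal to `X S` is the same as one whose product with `X` is orthogonal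
to `S`. -/
theorem mem_orth_mul {τ : L →ₗ[F] F} {X S : Submodule F L} {u : L} :
    u ∈ orth τ (X * S) ↔ ∀ x ∈ X, ∀ s ∈ S, τ (x * s * u) = 0 := by
  refine ⟨fun h x hx s hs => h _ (Submodule.mul_mem_mul hx hs), fun h a ha => ?_⟩
  refine Submodule.mul_induction_on ha (fun x hx s hs => h x hx s hs) fun a b ha hb => ?_
  rw [mulForm_apply] at *
  rw [add_mul, map_add, ha, hb, add_zero]

end

/-! ### Kernels: minimal saturated subspaces that are not stable -/

section

variable {F : Type u} {L : Type v} [Field F] [Field L] [Algebra F L] [FiniteDimensional F L]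

/-- `N` has least dimension among the saturated subspaces with the same boundary that are not
`R`-stable, and all saturated subspaces of smaller boundary are `R`-stable. -/
structure IsKernel (S : Submodule F L) (R : IntermediateField F L) (N : Submodule F L) :
    Prop where
  isSat : IsSat S N
  not_stable : ¬ IsStable R N
  stable_of_lt : ∀ Z, IsSat S Z → bd S Z < bd S N → IsStable R Z
  le_of_eq : ∀ Z, IsSat S Z → bd S Z = bd S N → ¬ IsStable R Z → finrank F N ≤ finrank F Z

namespace IsKernel

variable {S N : Submodule F L} {R : IntermediateField F L}

theorem dilate_of_ne_zero (h : IsKernel S R N) {y : L} (hy : y ≠ 0) : IsKernel S R (dilate y N) where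
  isSat := h.isSat.dilate hy
  not_stable := by rw [isStable_dilate_iff hy]; exact h.not_stable
  stable_of_lt Z hZ hlt := h.stable_of_lt Z hZ (by rwa [bd_dilate S N hy] at hlt)
  le_of_eq Z hZ heq hs := by
    rw [finrank_dilate hy]
    exact h.le_of_eq Z hZ (by rwa [bd_dilate S N hy] at heq) hs

/-- If a subspace has boundary at most that of the kernel and its saturation is not stable, then
its dimension is at least that of the kernel. -/
theorem finrank_le (h : IsKernel S R N) {M : Submodule F L} (hM : bd S M ≤ bd S N)
    (hs : ¬ IsStable R (sat S M)) : finrank F N ≤ finrank F M ∧ sat S M = M := by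
  have h1 : bd S N ≤ bd S (sat S M) := by
    by_contra hlt
    exact hs (h.stable_of_lt _ (isSat_sat S M) (by omega))
  have h2 := bd_sat_le S M
  have h3 := h.le_of_eq _ (isSat_sat S M) (by omega) hs
  have h4 : sat S M = M := by
    refine (Submodule.eq_of_le_of_finrank_le (le_sat S M) ?_).symm
    have h5 : finrank F ↥(sat S M * S) = finrank F ↥(M * S) := by rw [sat_mul]
    simp only [bd] at h1 h2 hM
    omega
  exact ⟨h4 ▸ h3, h4⟩

/-- The saturation of N ⊓ Y lies in N and contains 1. Were it R-stable, it would contain R, contrary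
to `hR`; so N ⊓ Y competes with N, and minimality gives N ⊓ Y = N. -/
theorem le_of_bd_inf_le (h : IsKernel S R N) (h1 : (1 : L) ∈ N) (hR : ¬ fieldSpace R ≤ N)
    {Y : Submodule F L} (hY : (1 : L) ∈ Y) (hbd : bd S (N ⊓ Y) ≤ bd S N) : N ≤ Y := by
  have hle : sat S (N ⊓ Y) ≤ N := h.isSat.sat_le inf_le_left
  have hs : ¬ IsStable R (sat S (N ⊓ Y)) := fun hs =>
    hR ((hs.le (le_sat S _ ⟨h1, hY⟩)).trans hle)
  have := (h.finrank_le hbd hs).1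
  rw [← Submodule.eq_of_le_of_finrank_le inf_le_left this]
  exact inf_le_right

/-- Normalisation: if x ∈ N and e x ∉ N with e ∈ R, division by x brings 1 into the space and keeps
e out. -/
theorem exists_dilate (h : IsKernel S R N) :
    ∃ y ≠ 0, (1 : L) ∈ dilate y N ∧ ¬ fieldSpace R ≤ dilate y N := by
  have := h.not_stable
  simp only [IsStable, not_forall] at this
  obtain ⟨e, he, x, hx, hex⟩ := this
  have hx0 : x ≠ 0 := by rintro rfl; exact hex (by simp)
  refine ⟨x⁻¹, inv_ne_zero hx0, mem_dilate.2 ⟨x, hx, inv_mul_cancel₀ hx0⟩, fun hle => ?_⟩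
  obtain ⟨z, hz, hze⟩ := mem_dilate.1 (hle he)
  refine hex ?_
  rw [← hze, mul_comm, ← mul_assoc, mul_inv_cancel₀ hx0, one_mul]
  exact hz

end IsKernel

theorem finrank_sup_of_disjoint {A B : Submodule F L} (h : A ⊓ B = ⊥) :
    finrank F ↥(A ⊔ B) = finrank F A + finrank F B := by
  have := Submodule.finrank_sup_add_finrank_inf_eq A B
  rw [h, finrank_bot] at this
  omega

/-- A nonzero n ∈ N is invertible in E, so p n ∈ D would give p ∈ D. -/
theorem dilate_inf_eq_bot {E : IntermediateField F L} {N D : Submodule F L} {p : L}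
    (hN : N ≤ fieldSpace E) (hD : IsStable E D) (hp : p ∉ D) : dilate p N ⊓ D = ⊥ := by
  refine (Submodule.eq_bot_iff _).2 fun x hx => ?_
  obtain ⟨hx1, hx2⟩ := Submodule.mem_inf.1 hx
  obtain ⟨n, hn, rfl⟩ := mem_dilate.1 hx1
  by_contra h0
  have hn0 : n ≠ 0 := by rintro rfl; simp at h0
  refine hp ?_
  have := hD n⁻¹ (E.inv_mem (hN hn)) _ hx2
  rwa [mul_comm p n, ← mul_assoc, inv_mul_cancel₀ hn0, one_mul] at this

theorem isStable_dilate_fieldSpace (E : IntermediateField F L) (p : L) :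
    IsStable E (dilate p (fieldSpace E)) := (isStable_fieldSpace E).dilate p

/-- The proof dualises with the form τ(xy). Put U = (N S)^⊥ and D = (E S)^⊥; then D ≤ U, and the
claim is dim U - dim D ≥ dim N. Since U is not R-stable while D is, some p lies in U but not in D.
Either U is covered by p E + D and yields a competitor of N, or U has a second direction q,
independent of p over E modulo D. -/
theorem IsKernel.finrank_le_finrank_mul {S N : Submodule F L} {R E : IntermediateField F L}
    (h : IsKernel S R N) (hRE : R ≤ E) (hNE : N ≤ fieldSpace E)
    (hbd : bd S N + 2 ≤ finrank F S) :
    2 * (finrank F N : ℤ) + bd S N ≤ finrank F ↥(fieldSpace E * S) := by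
  obtain ⟨τ, hτ⟩ := exists_functional F L
  set U := orth τ (N * S) with hU
  set D := orth τ (fieldSpace E * S) with hD
  have hDs : IsStable E D := ((isStable_fieldSpace E).mul_right S).orth
  have hDU : D ≤ U := orth_anti (mul_le_mul' hNE le_rfl)
  have dU := finrank_orth_add hτ (N * S)
  have dD := finrank_orth_add hτ (fieldSpace E * S)
  rw [← hU] at dU
  rw [← hD] at dD
  have hUs : ¬ IsStable R U := by
    intro hs
    refine h.not_stable (h.isSat.isStable ?_)
    rw [← orth_orth hτ (N * S)]
    exact hs.orth
  obtain ⟨p, hpU, hpD⟩ : ∃ p ∈ U, p ∉ D := by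
    by_contra! hc
    have : U = D := le_antisymm hc hDU
    exact hUs (this ▸ hDs.mono hRE)
  by_cases hq : U ≤ dilate p (fieldSpace E) ⊔ D
  -- Here U = p M ⊕ D. Because M S is orthogonal to p N ⊕ D, the boundary of M is at most that of N.
  -- Minimality of N gives dim N ≤ dim M = dim U - dim D.
  · set M : Submodule F L := fieldSpace E ⊓ U.comap (LinearMap.mulRight F p) with hM
    have memM : ∀ x, x ∈ M ↔ x ∈ E ∧ x * p ∈ U := fun x => by
      simp [hM]
    have hUM : U = dilate p M ⊔ D := by
      refine le_antisymm (fun u hu => ?_) (sup_le (fun x hx => ?_) hDU)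
      · obtain ⟨a, ha, d, hd, rfl⟩ := Submodule.mem_sup.1 (hq hu)
        refine Submodule.add_mem_sup ?_ hd
        obtain ⟨e, he, rfl⟩ := mem_dilate.1 ha
        refine mem_dilate.2 ⟨e, (memM e).2 ⟨he, ?_⟩, rfl⟩
        rw [mul_comm]
        simpa using sub_mem hu (hDU hd)
      · obtain ⟨e, he, rfl⟩ := mem_dilate.1 hx
        rw [mul_comm]
        exact ((memM e).1 he).2
    have hp0 : p ≠ 0 := by rintro rfl; exact hpD (zero_mem _)
    have hME : M ≤ fieldSpace E := inf_le_left
    have dUM : finrank F U = finrank F M + finrank F D := by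
      rw [hUM, finrank_sup_of_disjoint (dilate_inf_eq_bot hME hDs hpD), finrank_dilate hp0]
    have hMS : M * S ≤ orth τ (dilate p N ⊔ D) := by
      refine Submodule.mul_le.2 fun m hm s hs a ha => ?_
      obtain ⟨b, hb, d, hd, rfl⟩ := Submodule.mem_sup.1 ha
      obtain ⟨n, hn, rfl⟩ := mem_dilate.1 hb
      have h1 := mem_orth_mul.1 ((memM m).1 hm).2 n hn s hs
      have h2 := mem_orth_mul.1 hd m (hME hm) s hs
      rw [mulForm_apply, add_mul, map_add]
      rw [show p * n * (m * s) = n * s * (m * p) by ring, h1, mul_comm d, h2, add_zero]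
    have dMS := Submodule.finrank_mono hMS
    have dO := finrank_orth_add hτ (dilate p N ⊔ D)
    rw [finrank_sup_of_disjoint (dilate_inf_eq_bot hNE hDs hpD), finrank_dilate hp0] at dO
    have hbdM : bd S M ≤ bd S N := by simp only [bd]; omega
    -- If R stabilised the saturation, then r m would also lie in E and multiply S into the
    -- orthogonal complement of p N. That makes r m p orthogonal to N S, so M, and with it U, would
    -- be R-stable.
    have hns : ¬ IsStable R (sat S M) := by
      intro hs
      refine hUs ?_
      have : IsStable R M := by
        intro r hr m hm
        refine (memM _).2 ⟨E.mul_mem (hRE hr) (hME hm), mem_orth_mul.2 fun n hn s hs' => ?_⟩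
        have h1 := mem_sat.1 (hs r hr m (le_sat S M hm)) s hs'
        have h2 := hMS h1 (p * n) (Submodule.mem_sup_left (mul_mem_dilate hn))
        rw [mulForm_apply] at h2
        rw [← h2]
        congr 1
        ring
      rw [hUM]
      exact (this.dilate p).sup (hDs.mono hRE)
    have := (h.finrank_le hbdM hns).1
    simp only [bd]
    omega
  · obtain ⟨q, hqU, hq⟩ := SetLike.not_le_iff_exists.1 hq
    have hp0 : p ≠ 0 := by rintro rfl; exact hpD (zero_mem _)
    have hq0 : q ≠ 0 := by rintro rfl; exact hq (zero_mem _)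
    have d1 := finrank_sup_of_disjoint (dilate_inf_eq_bot hNE hDs hpD)
    have d2 := finrank_sup_of_disjoint
      (dilate_inf_eq_bot hNE ((isStable_dilate_fieldSpace E p).sup hDs) hq)
    -- Here q N, p N and D are independent inside S^⊥, so dim E S ≥ 2 dim N + dim S, which suffices
    -- by `hbd`.
    have hle : dilate q N ⊔ (dilate p N ⊔ D) ≤ orth τ S := by
      have aux : ∀ u ∈ U, dilate u N ≤ orth τ S := by
        intro u hu x hx s hs
        obtain ⟨n, hn, rfl⟩ := mem_dilate.1 hx
        have := mem_orth_mul.1 hu n hn s hs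
        rw [mulForm_apply, ← this]
        congr 1
        ring
      refine sup_le (aux q hqU) (sup_le (aux p hpU) ?_)
      refine orth_anti fun s hs => ?_
      simpa using Submodule.mul_mem_mul (one_mem_fieldSpace E) hs
    have hdis : dilate q N ⊓ (dilate p N ⊔ D) = ⊥ := by
      refine le_bot_iff.1 ?_
      rw [← dilate_inf_eq_bot hNE ((isStable_dilate_fieldSpace E p).sup hDs) hq]
      exact inf_le_inf le_rfl (sup_le_sup (dilate_mono p hNE) le_rfl)
    have d3 := finrank_sup_of_disjoint hdis
    have d4 := Submodule.finrank_mono hle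
    have d5 := finrank_orth_add hτ S
    rw [d1, finrank_dilate hp0, finrank_dilate hq0] at d3
    simp only [bd] at hbd ⊢
    omega

end

/-! ### The chain of level fields -/

section

variable {F : Type u} {L : Type v} [Field F] [Field L] [Algebra F L] [FiniteDimensional F L]

/-- The common stabiliser of the saturated subspaces of boundary less than `μ`. -/
def levelField (S : Submodule F L) (μ : ℕ) : IntermediateField F L :=
  commonStabilizer {X | IsSat S X ∧ bd S X < μ}

theorem isStable_levelField {S X : Submodule F L} {μ : ℕ} (hX : IsSat S X) (h : bd S X < μ) :
    IsStable (levelField S μ) X :=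
  isStable_commonStabilizer (show X ∈ {X | IsSat S X ∧ bd S X < μ} from ⟨hX, h⟩)

theorem le_levelField {S : Submodule F L} {μ : ℕ} {E : IntermediateField F L}
    (h : ∀ X, IsSat S X → bd S X < μ → IsStable E X) : E ≤ levelField S μ :=
  le_commonStabilizer fun X hX => h X hX.1 hX.2

theorem levelField_anti (S : Submodule F L) : Antitone (levelField S) := fun μ ν h =>
  le_levelField fun X hX hlt => isStable_levelField hX (hlt.trans_le (by exact_mod_cast h))

theorem levelField_zero {S : Submodule F L} (hS : S ≠ ⊥) : levelField S 0 = ⊤ :=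
  top_le_iff.1 (le_levelField fun X _ hlt => absurd (bd_nonneg hS X) (by simpa using hlt))

/-- Passing from level `μ` to `μ + 1` either changes nothing, or the new field has boundary `μ`
and a smaller product with `S`. -/
def IsRegular (S : Submodule F L) (μ : ℕ) : Prop :=
  levelField S (μ + 1) = levelField S μ ∨
    (bd S (fieldSpace (levelField S (μ + 1))) = μ ∧
      fieldSpace (levelField S (μ + 1)) * S ≠ fieldSpace (levelField S μ) * S)

/-- The saturation of Y also has boundary < μ, so the level field stabilises it. As it contains 1,
it contains the level field, and it has the same product with S as Y. -/
theorem mul_eq_of_bd_lt {S Y : Submodule F L} {μ : ℕ} (h1 : (1 : L) ∈ Y)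
    (hY : Y ≤ fieldSpace (levelField S μ)) (h : bd S Y < μ) :
    Y * S = fieldSpace (levelField S μ) * S := by
  refine le_antisymm (mul_le_mul' hY le_rfl) ?_
  rw [← sat_mul S Y]
  refine mul_le_mul' ?_ le_rfl
  exact (isStable_levelField (isSat_sat S Y) ((bd_sat_le S Y).trans_lt h)).le (le_sat S Y h1)

theorem finrank_sup_lt {A B : Submodule F L} (hA : (1 : L) ∈ A) (hB : (1 : L) ∈ B) :
    finrank F ↥(A ⊔ B) + 1 ≤ finrank F A + finrank F B := by
  have h1 := Submodule.finrank_sup_add_finrank_inf_eq A B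
  have h2 : 1 ≤ finrank F ↥(A ⊓ B) := by
    rw [Submodule.one_le_finrank_iff]
    exact (Submodule.ne_bot_iff _).2 ⟨1, ⟨hA, hB⟩, one_ne_zero⟩
  omega

/-- For subfields `E' ≤ E` with `E' S ≠ E S`, the space `E S / E' S` is a nonzero `E'`-space. -/
theorem finrank_add_le_of_mul_ne {S : Submodule F L} {E E' : IntermediateField F L} (h : E' ≤ E)
    (hne : fieldSpace E' * S ≠ fieldSpace E * S) :
    2 * (finrank F (fieldSpace E') : ℤ) + bd S (fieldSpace E') ≤
      finrank F ↥(fieldSpace E * S) := by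
  have hle : fieldSpace E' * S ≤ fieldSpace E * S := mul_le_mul' (fieldSpace_le.2 h) le_rfl
  obtain ⟨x, hx, hx'⟩ := SetLike.exists_of_lt (lt_of_le_of_ne hle hne)
  have h1 := dilate_inf_eq_bot (le_refl (fieldSpace E')) ((isStable_fieldSpace E').mul_right S) hx'
  have hx0 : x ≠ 0 := by rintro rfl; exact hx' (zero_mem _)
  have h2 := finrank_sup_of_disjoint h1
  rw [finrank_dilate hx0] at h2
  have h3 : finrank F ↥(dilate x (fieldSpace E') ⊔ fieldSpace E' * S) ≤
      finrank F ↥(fieldSpace E * S) := by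
    refine Submodule.finrank_mono (sup_le (fun z hz => ?_) hle)
    obtain ⟨e, he, rfl⟩ := mem_dilate.1 hz
    rw [mul_comm x e]
    exact (isStable_fieldSpace E).mul_right S e (h he) x hx
  simp only [bd]
  omega

/-- Descent along the chain. Suppose the field drops to K after level μ and N ⊓ K has boundary above
`lam`. By submodularity N ⊔ K has boundary < μ, so its product with S is that of the level field.
The lower bounds on this product coming from N and from K add up to a contradiction, since N and K
share the element 1. -/
theorem IsKernel.le_levelField {S N : Submodule F L} {R : IntermediateField F L} {lam : ℕ}
    (hS : S ≠ ⊥) (h : IsKernel S R N) (hlam : bd S N = lam) (hreg : ∀ μ < lam, IsRegular S μ)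
    (hbd : lam + 2 ≤ finrank F S) (hR : R ≤ levelField S lam) (h1 : (1 : L) ∈ N)
    (hRN : ¬ fieldSpace R ≤ N) : ∀ μ ≤ lam, N ≤ fieldSpace (levelField S μ) := by
  intro μ
  induction μ with
  | zero => intro _; rw [levelField_zero hS]; exact fun _ _ => trivial
  | succ μ ih =>
    intro hμ
    have hN := ih (by omega)
    rcases hreg μ (by omega) with heq | ⟨hb, hne⟩
    · rwa [heq]
    have hanti := levelField_anti S (Nat.le_add_right μ 1)
    have hsub := bd_inf_add_bd_sup S N (fieldSpace (levelField S (μ + 1)))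
    refine h.le_of_bd_inf_le h1 hRN (one_mem_fieldSpace _) ?_
    by_contra hlt
    have hlt' : bd S (N ⊔ fieldSpace (levelField S (μ + 1))) < μ := by omega
    have hprod := mul_eq_of_bd_lt (Submodule.mem_sup_left h1)
      (sup_le hN (fieldSpace_le.2 hanti)) hlt'
    have i1 := h.finrank_le_finrank_mul (E := levelField S μ)
      (hR.trans (levelField_anti S (by omega))) hN (by omega)
    have i2 := finrank_add_le_of_mul_ne hanti hne
    have i3 := finrank_sup_lt h1 (one_mem_fieldSpace (levelField S (μ + 1)))
    rw [bd, hprod] at hlt'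
    omega

theorem exists_isKernel {S : Submodule F L} {R : IntermediateField F L} {lam : ℕ}
    (hlow : ∀ Z, IsSat S Z → bd S Z < lam → IsStable R Z)
    (hex : ∃ X, IsSat S X ∧ bd S X = lam ∧ ¬ IsStable R X) :
    ∃ N, IsKernel S R N ∧ bd S N = lam ∧ (1 : L) ∈ N ∧ ¬ fieldSpace R ≤ N := by
  classical
  have hex' : ∃ d, ∃ X, (IsSat S X ∧ bd S X = lam ∧ ¬ IsStable R X) ∧ finrank F X = d := by
    obtain ⟨X, hX⟩ := hex
    exact ⟨_, X, hX, rfl⟩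
  obtain ⟨N, ⟨hN1, hN2, hN3⟩, hNd⟩ := Nat.find_spec hex'
  have hk : IsKernel S R N :=
    { isSat := hN1
      not_stable := hN3
      stable_of_lt := fun Z hZ hlt => hlow Z hZ (hN2 ▸ hlt)
      le_of_eq := fun Z hZ heq hs => by
        rw [hNd]
        exact Nat.find_min' hex' ⟨Z, ⟨hZ, heq.trans hN2, hs⟩, rfl⟩ }
  obtain ⟨y, hy, h1, hR⟩ := hk.exists_dilate
  exact ⟨dilate y N, hk.dilate_of_ne_zero hy, (bd_dilate S N hy).trans hN2, h1, hR⟩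

/-- If the chain drops after `lam`, a kernel N for the current field H exists and lies in H.
Uncrossing N with x⁻¹ N for x ∈ N shows that N is closed under multiplication, so N is a field R of
boundary `lam`. Uncrossing N with a kernel for R shows that R stabilises every saturated subspace of
boundary ≤ `lam`; hence R is the next level field. -/
theorem isRegular_of_forall_lt {S : Submodule F L} (hS : S ≠ ⊥) {lam : ℕ}
    (hreg : ∀ μ < lam, IsRegular S μ) (hbd : lam + 2 ≤ finrank F S) : IsRegular S lam := by
  by_cases heq : levelField S (lam + 1) = levelField S lam
  · exact Or.inl heq
  set H := levelField S lam with hH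
  have hlowH : ∀ Z, IsSat S Z → bd S Z < lam → IsStable H Z := fun Z hZ hlt =>
    isStable_levelField hZ hlt
  have hex : ∃ X, IsSat S X ∧ bd S X = lam ∧ ¬ IsStable H X := by
    by_contra! hc
    refine heq (le_antisymm (levelField_anti S (Nat.le_add_right lam 1)) ?_)
    refine le_levelField fun X hX hlt => ?_
    rcases lt_or_eq_of_le (show bd S X ≤ lam by push_cast at hlt; omega) with h | h
    · exact hlowH X hX h
    · exact hc X hX h
  obtain ⟨N, hN, hNl, h1, hHN⟩ := exists_isKernel hlowH hex
  have hNH : N ≤ fieldSpace H := hN.le_levelField hS hNl hreg hbd le_rfl h1 hHN lam le_rfl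
  have key := hN.finrank_le_finrank_mul le_rfl hNH (by omega)
  -- `N` is multiplicatively closed
  have hmul : ∀ x ∈ N, ∀ z ∈ N, x * z ∈ N := by
    intro x hx z hz
    rcases eq_or_ne x 0 with rfl | hx0
    · simp
    have h1' : (1 : L) ∈ dilate x⁻¹ N := mem_dilate.2 ⟨x, hx, inv_mul_cancel₀ hx0⟩
    have hle : N ≤ dilate x⁻¹ N := by
      refine hN.le_of_bd_inf_le h1 hHN h1' ?_
      -- Otherwise N ⊔ x⁻¹ N has boundary < `lam`, so its product with S is H S. Then dim H S <
      -- `lam` + 2 dim N, contradicting `key`.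
      by_contra hlt
      have hsub := bd_inf_add_bd_sup S N (dilate x⁻¹ N)
      rw [bd_dilate S N (inv_ne_zero hx0)] at hsub
      have hlt' : bd S (N ⊔ dilate x⁻¹ N) < lam := by omega
      have hdH : dilate x⁻¹ N ≤ fieldSpace H := fun w hw => by
        obtain ⟨v, hv, rfl⟩ := mem_dilate.1 hw
        exact H.mul_mem (H.inv_mem (hNH hx)) (hNH hv)
      have hprod := mul_eq_of_bd_lt (Submodule.mem_sup_left h1) (sup_le hNH hdH) hlt'
      have i3 := finrank_sup_lt h1 h1'
      rw [finrank_dilate (inv_ne_zero hx0)] at i3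
      rw [bd, hprod, ← hH] at hlt'
      omega
    obtain ⟨w, hw, hwz⟩ := mem_dilate.1 (hle hz)
    rw [← hwz, ← mul_assoc, mul_inv_cancel₀ hx0, one_mul]
    exact hw
  set R := commonStabilizer {N} with hRdef
  have hRN : fieldSpace R = N := by
    refine le_antisymm ?_ ?_
    · exact (isStable_commonStabilizer (Set.mem_singleton N)).le h1
    · intro x hx X hX
      rw [Set.mem_singleton_iff] at hX
      subst hX
      exact hmul x hx
  have hRH : R ≤ H := by rw [← fieldSpace_le, hRN]; exact hNH
  have hall : ∀ X, IsSat S X → bd S X < (lam + 1 : ℕ) → IsStable R X := by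
    intro X hX hlt
    rcases lt_or_eq_of_le (show bd S X ≤ lam by push_cast at hlt; omega) with h | h
    · exact (hlowH X hX h).mono hRH
    by_contra hns
    obtain ⟨Y, hY, hYl, hY1, hRY⟩ :=
      exists_isKernel (fun Z hZ hlt => (hlowH Z hZ hlt).mono hRH) ⟨X, hX, h, hns⟩
    have hYH : Y ≤ fieldSpace H := hY.le_levelField hS hYl hreg hbd hRH hY1 hRY lam le_rfl
    have keyY := hY.finrank_le_finrank_mul hRH hYH (by omega)
    refine hRY (hRN ▸ hN.le_of_bd_inf_le h1 hHN hY1 ?_)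
    by_contra hlt
    have hsub := bd_inf_add_bd_sup S N Y
    have hlt' : bd S (N ⊔ Y) < lam := by omega
    have hprod := mul_eq_of_bd_lt (Submodule.mem_sup_left h1) (sup_le hNH hYH) hlt'
    have i3 := finrank_sup_lt h1 hY1
    rw [bd, hprod, ← hH] at hlt'
    omega
  have hKR : levelField S (lam + 1) = R := by
    refine le_antisymm ?_ (le_levelField hall)
    rw [← fieldSpace_le, hRN]
    exact (isStable_levelField hN.isSat (by rw [hNl]; exact_mod_cast Nat.lt_succ_self lam)).le h1
  refine Or.inr ⟨by rw [hKR, hRN, hNl], ?_⟩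
  rw [hKR, hRN]
  intro hc
  -- If N S = H S, then H lies in the saturation of N, which is N.
  refine hHN fun x hx => hN.isSat (mem_sat.2 fun s hs => ?_)
  rw [hc]
  exact Submodule.mul_mem_mul hx hs

theorem isRegular {S : Submodule F L} (hS : S ≠ ⊥) (μ : ℕ) (hμ : μ + 2 ≤ finrank F S) :
    IsRegular S μ := by
  induction μ using Nat.strong_induction_on with
  | _ μ ih => exact isRegular_of_forall_lt hS (fun ν hν => ih ν hν (by omega)) hμ

theorem finrank_fieldSpace_bot : finrank F (fieldSpace (⊥ : IntermediateField F L)) = 1 :=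
  IntermediateField.finrank_bot

/-- A drop after level μ lands on a field of boundary exactly μ, whereas the base field has boundary
dim S - 1, which exceeds every μ allowed here. -/
theorem levelField_ne_bot {S : Submodule F L} (hn : finrank F L ≠ 1) (hS : S ≠ ⊥) (μ : ℕ)
    (hμ : μ + 1 ≤ finrank F S) : levelField S μ ≠ ⊥ := by
  induction μ with
  | zero =>
    rw [levelField_zero hS]
    intro h
    have := IntermediateField.finrank_top' (F := F) (E := L)
    rw [h, IntermediateField.finrank_bot] at this
    exact hn this.symm
  | succ μ ih =>
    rcases isRegular hS μ (by omega) with h | ⟨h, -⟩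
    · rw [h]; exact ih (by omega)
    · intro hc
      rw [hc, bd, finrank_fieldSpace_bot] at h
      have : fieldSpace (⊥ : IntermediateField F L) * S = S := by
        rw [show fieldSpace (⊥ : IntermediateField F L) = 1 from ?_, one_mul]
        ext x
        rw [mem_fieldSpace, IntermediateField.mem_bot, Submodule.mem_one]
        rfl
      rw [this] at h
      omega

/-- A product of subspaces of small dimension is a vector space over a larger field. -/
theorem exists_isStable_mul {X S : Submodule F L} (hX : X ≠ ⊥) (hS : S ≠ ⊥)
    (h : finrank F ↥(X * S) + 1 < finrank F X + finrank F S) :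
    ∃ E : IntermediateField F L, E ≠ ⊥ ∧ IsStable E (X * S) := by
  have hpos := Submodule.one_le_finrank_iff.2 hS
  have hX1 := Submodule.one_le_finrank_iff.2 hX
  have h0 := bd_nonneg hS X
  have hbd := bd_sat_le S X
  simp only [bd] at h0
  have hn : finrank F L ≠ 1 := by
    intro hn
    have := Submodule.finrank_le X
    have := Submodule.finrank_le S
    omega
  -- The hypothesis says that the boundary of X is < dim S - 1, so this level field stabilises the
  -- saturation of X.
  refine ⟨levelField S (finrank F S - 1), levelField_ne_bot hn hS _ (by omega), ?_⟩
  rw [← sat_mul S X]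
  refine IsStable.mul_right (isStable_levelField (isSat_sat S X) ?_) S
  refine hbd.trans_lt ?_
  simp only [bd]
  omega

end

/-! ### Kneser's theorem with its stabiliser -/

section

variable {F : Type u} {L : Type v} [Field F] [Field L] [Algebra F L] [FiniteDimensional F L]

theorem restrictScalars_span (H : IntermediateField F L) (X : Submodule F L) :
    (Submodule.span H (X : Set L)).restrictScalars F = fieldSpace H * X := by
  refine le_antisymm (fun x hx => ?_) (Submodule.mul_le.2 fun e he x hx => ?_)
  · rw [Submodule.restrictScalars_mem] at hx
    induction hx using Submodule.span_induction with
    | mem x hx => simpa using Submodule.mul_mem_mul (one_mem_fieldSpace H) hx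
    | zero => exact zero_mem _
    | add x y _ _ hx hy => exact add_mem hx hy
    | smul e x _ hx => exact (isStable_fieldSpace H).mul_right X e e.2 x hx
  · exact Submodule.smul_mem _ (⟨e, he⟩ : H) (Submodule.subset_span hx)

theorem finrank_fieldSpace_mul (H : IntermediateField F L) (X : Submodule F L) :
    finrank F ↥(fieldSpace H * X) = finrank F H * finrank H (Submodule.span H (X : Set L)) := by
  rw [← restrictScalars_span, finrank_mul_finrank]
  exact (Submodule.restrictScalarsEquiv F H L (Submodule.span H (X : Set L))).restrictScalars F
    |>.finrank_eq

theorem le_fieldSpace_mul (H : IntermediateField F L) (X : Submodule F L) :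
    X ≤ fieldSpace H * X := fun x hx => by
  simpa using Submodule.mul_mem_mul (one_mem_fieldSpace H) hx

/-- **Kneser's theorem for field extensions**: if `H` is the stabiliser of `A B`, then
`dim A B ≥ dim A H + dim B H - dim H`. -/
theorem exists_finrank_add_le {A B : Submodule F L} (hA : A ≠ ⊥) (hB : B ≠ ⊥) :
    ∃ H : IntermediateField F L, IsStable H (A * B) ∧
      finrank F ↥(fieldSpace H * A) + finrank F ↥(fieldSpace H * B) ≤
        finrank F ↥(A * B) + finrank F H := by
  set H := commonStabilizer {A * B} with hH
  have hst : IsStable H (A * B) := isStable_commonStabilizer (Set.mem_singleton _)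
  refine ⟨H, hst, ?_⟩
  set A' := Submodule.span H (A : Set L) with hA'
  set B' := Submodule.span H (B : Set L) with hB'
  have hAB : A' * B' = Submodule.span H ((A * B : Submodule F L) : Set L) := by
    rw [hA', hB', Submodule.span_mul_span, Submodule.mul_eq_span_mul_set,
      Submodule.span_span_of_tower]
  have hres : (A' * B').restrictScalars F = A * B := by
    rw [hAB, restrictScalars_span, hst.fieldSpace_mul]
  have hbot : ∀ X : Submodule F L, X ≠ ⊥ → Submodule.span H (X : Set L) ≠ ⊥ := by
    intro X hX hc
    refine hX ((Submodule.eq_bot_iff _).2 fun x hx => ?_)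
    have := Submodule.subset_span (R := H) hx
    rwa [hc] at this
  -- Over H the stabiliser of A' B' is trivial by the choice of H, so the product cannot be
  -- deficient.
  have key : finrank H A' + finrank H B' ≤ finrank H ↥(A' * B') + 1 := by
    by_contra! hlt
    obtain ⟨E, hE, hEs⟩ := exists_isStable_mul (hbot A hA) (hbot B hB) hlt
    refine hE (le_bot_iff.1 fun e he => ?_)
    have : e ∈ H := by
      intro X hX x hx
      rw [Set.mem_singleton_iff] at hX
      subst hX
      rw [← hres] at hx ⊢
      exact hEs e he x hx
    exact IntermediateField.mem_bot.2 ⟨⟨e, this⟩, rfl⟩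
  have hABd : finrank F ↥(A * B) = finrank F H * finrank H ↥(A' * B') := by
    rw [hAB, ← finrank_fieldSpace_mul, hst.fieldSpace_mul]
  rw [finrank_fieldSpace_mul, finrank_fieldSpace_mul, hABd]
  calc _ = finrank F H * (finrank H A' + finrank H B') := by ring
    _ ≤ finrank F H * (finrank H ↥(A' * B') + 1) := Nat.mul_le_mul_left _ key
    _ = _ := by ring

theorem le_fieldSpace_of_finrank_mul_le {H : IntermediateField F L} {A : Submodule F L}
    (h1 : (1 : L) ∈ A) (h : finrank F ↥(fieldSpace H * A) ≤ finrank F H) : A ≤ fieldSpace H := by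
  have hle : fieldSpace H ≤ fieldSpace H * A := fun x hx => by
    simpa using Submodule.mul_mem_mul hx h1
  rw [Submodule.eq_of_le_of_finrank_le hle h]
  exact le_fieldSpace_mul H A

/-- Kneser's theorem in terms of dimensions over the stabiliser. -/
theorem exists_dims_of_mul {A B : Submodule F L} (hA : (1 : L) ∈ A) (hB : (1 : L) ∈ B) :
    ∃ (H : IntermediateField F L) (α β : ℕ), finrank F A ≤ finrank F H * α ∧
      finrank F B ≤ finrank F H * β ∧
      finrank F H * (α + β) ≤ finrank F ↥(A * B) + finrank F H ∧
      (α ≤ 1 → A ≤ fieldSpace H) ∧ (β ≤ 1 → B ≤ fieldSpace H) := by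
  obtain ⟨H, -, hH⟩ := exists_finrank_add_le
    ((Submodule.ne_bot_iff _).2 ⟨1, hA, one_ne_zero⟩)
    ((Submodule.ne_bot_iff _).2 ⟨1, hB, one_ne_zero⟩)
  refine ⟨H, finrank H (Submodule.span H (A : Set L)), finrank H (Submodule.span H (B : Set L)),
    ?_, ?_, ?_, ?_, ?_⟩
  · rw [← finrank_fieldSpace_mul]; exact Submodule.finrank_mono (le_fieldSpace_mul H A)
  · rw [← finrank_fieldSpace_mul]; exact Submodule.finrank_mono (le_fieldSpace_mul H B)
  · rw [mul_add, ← finrank_fieldSpace_mul, ← finrank_fieldSpace_mul]; exact hH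
  · intro h
    refine le_fieldSpace_of_finrank_mul_le hA ?_
    rw [finrank_fieldSpace_mul]
    exact (Nat.mul_le_mul_left _ h).trans (mul_one _).le
  · intro h
    refine le_fieldSpace_of_finrank_mul_le hB ?_
    rw [finrank_fieldSpace_mul]
    exact (Nat.mul_le_mul_left _ h).trans (mul_one _).le

end
end LinearKneser

theorem leastIndex_spec {n : ℕ} (p : Fin n → Prop) (h : ∃ k, p k) : p (leastIndex p h) :=
  wellFounded_lt.min_mem {k | p k} h

theorem leastIndex_le {n : ℕ} {p : Fin n → Prop} (h : ∃ k, p k) {k : Fin n} (hk : p k) :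
    leastIndex p h ≤ k :=
  not_lt.1 (wellFounded_lt.not_lt_min {k | p k} hk)

/-! ### Mixed radix addition and the standard flag type -/

namespace TowerType

variable (𝔗 : TowerType)

/-- The entries of a tower type, continued by ones. -/
def natEntry (r : ℕ) : ℕ := if h : r < 𝔗.length then 𝔗.entry ⟨r, h⟩ else 1

/-- The product of the first `s` entries of a tower type. -/
def partialDegree (s : ℕ) : ℕ := ∏ r ∈ Finset.range s, 𝔗.natEntry r

theorem natEntry_of_lt {r : ℕ} (h : r < 𝔗.length) : 𝔗.natEntry r = 𝔗.entry ⟨r, h⟩ := dif_pos h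

theorem natEntry_pos (r : ℕ) : 0 < 𝔗.natEntry r := by
  rw [natEntry]
  split_ifs with h
  · exact (𝔗.one_lt _).le
  · exact one_pos

@[simp] theorem partialDegree_zero : 𝔗.partialDegree 0 = 1 := rfl

theorem partialDegree_succ (s : ℕ) :
    𝔗.partialDegree (s + 1) = 𝔗.partialDegree s * 𝔗.natEntry s := Finset.prod_range_succ _ _

theorem partialDegree_pos (s : ℕ) : 0 < 𝔗.partialDegree s :=
  Finset.prod_pos fun r _ => 𝔗.natEntry_pos r

theorem partialDegree_dvd {r s : ℕ} (h : r ≤ s) : 𝔗.partialDegree r ∣ 𝔗.partialDegree s :=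
  Finset.prod_dvd_prod_of_subset _ _ _ (Finset.range_mono h)

theorem partialDegree_length : 𝔗.partialDegree 𝔗.length = 𝔗.degree := by
  rw [partialDegree, Finset.prod_range, degree]
  exact Finset.prod_congr rfl fun s _ => 𝔗.natEntry_of_lt s.2

theorem partialDegree_lt_succ {s : ℕ} (h : s < 𝔗.length) :
    𝔗.partialDegree s < 𝔗.partialDegree (s + 1) := by
  rw [partialDegree_succ, natEntry_of_lt _ h]
  exact lt_mul_of_one_lt_right (𝔗.partialDegree_pos s) (𝔗.one_lt _)

theorem degree_pos : 0 < 𝔗.degree := 𝔗.partialDegree_length ▸ 𝔗.partialDegree_pos _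

theorem digit_eq (i : Fin 𝔗.degree) (s : Fin 𝔗.length) :
    𝔗.digit i s = (i : ℕ) / 𝔗.partialDegree s % 𝔗.natEntry s := by
  rw [digit, partialDegree, Finset.prod_range, natEntry_of_lt _ s.2]
  congr 2
  exact Finset.prod_congr rfl fun r _ => (𝔗.natEntry_of_lt (r.2.trans s.2)).symm

theorem digit_lt (i : Fin 𝔗.degree) (s : Fin 𝔗.length) : 𝔗.digit i s < 𝔗.entry s :=
  Nat.mod_lt _ (zero_lt_one.trans (𝔗.one_lt s))

/-- No carry occurs when `i` and `j` are added in the mixed radix system. -/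
def NoCarry (i j : ℕ) : Prop :=
  ∀ s, i % 𝔗.partialDegree s + j % 𝔗.partialDegree s < 𝔗.partialDegree s

/-- The digits of k are the digitwise sums modulo n_r of those of a and b. Induction on the number
of digits compares this carry-free sum with a genuine one. -/
theorem exists_noCarry_aux {a b k : ℕ} (s : ℕ)
    (h : ∀ r < s, k / 𝔗.partialDegree r % 𝔗.natEntry r =
      (a / 𝔗.partialDegree r % 𝔗.natEntry r + b / 𝔗.partialDegree r % 𝔗.natEntry r) %
        𝔗.natEntry r) :
    ∃ a' b', a' ≤ a % 𝔗.partialDegree s ∧ b' ≤ b % 𝔗.partialDegree s ∧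
      (∀ r ≤ s, a' % 𝔗.partialDegree r + b' % 𝔗.partialDegree r < 𝔗.partialDegree r) ∧
      k % 𝔗.partialDegree s ≤ a' + b' := by
  induction s with
  | zero =>
    refine ⟨0, 0, Nat.zero_le _, Nat.zero_le _, fun r hr => ?_, by simp [Nat.mod_one]⟩
    simpa using 𝔗.partialDegree_pos r
  | succ s ih =>
    obtain ⟨a', b', ha, hb, hnc, hk⟩ := ih fun r hr => h r (hr.trans (Nat.lt_succ_self s))
    have hs := h s (Nat.lt_succ_self s)
    have hn := 𝔗.natEntry_pos s
    have hM := 𝔗.partialDegree_pos s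
    have hnc' := hnc s le_rfl
    have hadvd : ∀ r ≤ s, 𝔗.partialDegree r ∣ 𝔗.partialDegree s := fun r hr =>
      𝔗.partialDegree_dvd hr
    rw [partialDegree_succ, Nat.mod_mul, Nat.mod_mul, Nat.mod_mul, hs]
    have hanlt : a / 𝔗.partialDegree s % 𝔗.natEntry s < 𝔗.natEntry s := Nat.mod_lt _ hn
    have hbnlt : b / 𝔗.partialDegree s % 𝔗.natEntry s < 𝔗.natEntry s := Nat.mod_lt _ hn
    have hamlt : a % 𝔗.partialDegree s < 𝔗.partialDegree s := Nat.mod_lt _ hM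
    have hbmlt : b % 𝔗.partialDegree s < 𝔗.partialDegree s := Nat.mod_lt _ hM
    generalize a / 𝔗.partialDegree s % 𝔗.natEntry s = an at *
    generalize b / 𝔗.partialDegree s % 𝔗.natEntry s = bn at *
    have hkm : k % 𝔗.partialDegree s < 𝔗.partialDegree s := Nat.mod_lt _ hM
    -- If the top digits do not overflow, they are appended to the pair given by induction.
    by_cases hc : an + bn < 𝔗.natEntry s
    · refine ⟨a' + 𝔗.partialDegree s * an, b' + 𝔗.partialDegree s * bn, by omega, by omega,
        fun r hr => ?_, ?_⟩
      · rcases Nat.lt_or_eq_of_le hr with hr | rfl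
        · obtain ⟨c, hc⟩ := hadvd r (by omega)
          have := hnc r (by omega)
          rw [hc, mul_assoc, mul_assoc, Nat.add_mul_mod_self_left, Nat.add_mul_mod_self_left]
          exact this
        · have hlt : a' + b' < 𝔗.partialDegree s := by
            rwa [Nat.mod_eq_of_lt (by omega), Nat.mod_eq_of_lt (by omega)] at hnc'
          have h1 : 𝔗.partialDegree s * (an + bn + 1) ≤
              𝔗.partialDegree s * 𝔗.natEntry s := Nat.mul_le_mul_left _ hc
          have h2 : 𝔗.partialDegree s * (an + bn + 1) = 𝔗.partialDegree s * an +
            𝔗.partialDegree s * bn + 𝔗.partialDegree s := by ring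
          have h3 := Nat.mod_le (a' + 𝔗.partialDegree s * an) (𝔗.partialDegree (s + 1))
          have h4 := Nat.mod_le (b' + 𝔗.partialDegree s * bn) (𝔗.partialDegree (s + 1))
          have h5 := 𝔗.partialDegree_succ s
          omega
      · rw [Nat.mod_eq_of_lt hc, mul_add]
        omega
    -- If they overflow, the truncations of a and b sum to at least P = n₁⋯n_{s+1}. Keep B and lower
    -- the other summand to P - 1 - B: the digits are complementary, so nothing carries, and the sum
    -- P - 1 bounds k mod P.
    · have hle : 𝔗.partialDegree s * (bn + 1) ≤ 𝔗.partialDegree s * 𝔗.natEntry s :=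
        Nat.mul_le_mul_left _ hbnlt
      have hle2 : 𝔗.partialDegree s * 𝔗.natEntry s ≤ 𝔗.partialDegree s * (an + bn) :=
        Nat.mul_le_mul_left _ (not_lt.1 hc)
      have hle3 : 𝔗.partialDegree s * ((an + bn) % 𝔗.natEntry s + 1) ≤
          𝔗.partialDegree s * 𝔗.natEntry s := Nat.mul_le_mul_left _ (Nat.mod_lt _ hn)
      rw [mul_add, mul_one] at hle hle3
      rw [mul_add] at hle2
      set B := b % 𝔗.partialDegree s + 𝔗.partialDegree s * bn with hB
      refine ⟨𝔗.partialDegree s * 𝔗.natEntry s - 1 - B, B, by omega, le_rfl, fun r hr => ?_,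
        by omega⟩
      obtain ⟨c, hc⟩ := 𝔗.partialDegree_dvd hr
      rw [partialDegree_succ] at hc
      have hr0 := 𝔗.partialDegree_pos r
      have hBlt : B < 𝔗.partialDegree r * c := by omega
      have hBm : B % 𝔗.partialDegree r < 𝔗.partialDegree r := Nat.mod_lt _ hr0
      have hdiv := Nat.div_add_mod B (𝔗.partialDegree r)
      have hq : B / 𝔗.partialDegree r < c := Nat.div_lt_of_lt_mul hBlt
      obtain ⟨e, he⟩ := Nat.exists_eq_add_of_lt hq
      have : 𝔗.partialDegree s * 𝔗.natEntry s - 1 - B =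
          (𝔗.partialDegree r - 1 - B % 𝔗.partialDegree r) + 𝔗.partialDegree r * e := by
        rw [hc]
        have : 𝔗.partialDegree r * c = 𝔗.partialDegree r * (B / 𝔗.partialDegree r) +
            𝔗.partialDegree r * e + 𝔗.partialDegree r := by rw [he]; ring
        omega
      rw [this, Nat.add_mul_mod_self_left, Nat.mod_eq_of_lt (by omega)]
      omega

/-- By minimality of T(i,j), the last element of that member of the flag is itself a product;
otherwise the preceding member would do. -/
theorem exists_elt_eq_mul (i j : Fin 𝔗.degree) :
    ∃ a ≤ i, ∃ b ≤ j, 𝔗.elt a * 𝔗.elt b = 𝔗.elt (𝔗.flagType i j) := by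
  have hs : 𝔗.flag.toSet i * 𝔗.flag.toSet j ⊆ 𝔗.flag.toSet (𝔗.flagType i j) :=
    leastIndex_spec _ (𝔗.flag.exists_mul_subset i j)
  by_contra! hc
  have hlt : ∀ a ≤ i, ∀ b ≤ j, ∃ c < 𝔗.flagType i j, 𝔗.elt a * 𝔗.elt b = 𝔗.elt c := by
    intro a ha b hb
    obtain ⟨c, hc1, hc2⟩ := hs (Set.mul_mem_mul (Set.mem_image_of_mem _ ha)
      (Set.mem_image_of_mem _ hb))
    refine ⟨c, lt_of_le_of_ne hc1 ?_, hc2.symm⟩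
    rintro rfl
    exact hc a ha b hb hc2.symm
  obtain ⟨c, hc0, -⟩ := hlt i le_rfl j le_rfl
  have hk : 0 < (𝔗.flagType i j : ℕ) := (Nat.zero_le _).trans_lt hc0
  have hk' : (𝔗.flagType i j : ℕ) - 1 < 𝔗.degree := (Nat.sub_le _ _).trans_lt (𝔗.flagType i j).2
  have : 𝔗.flagType i j ≤ ⟨(𝔗.flagType i j : ℕ) - 1, hk'⟩ := by
    refine leastIndex_le (𝔗.flag.exists_mul_subset i j) ?_
    rintro _ ⟨_, ⟨a, ha, rfl⟩, _, ⟨b, hb, rfl⟩, rfl⟩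
    obtain ⟨c, hc1, hc2⟩ := hlt a ha b hb
    exact ⟨c, Fin.le_def.2 (Nat.le_sub_one_of_lt hc1), hc2.symm⟩
  have := Fin.le_def.1 this
  simp only at this
  omega

theorem exists_noCarry (i j : Fin 𝔗.degree) :
    ∃ a b : ℕ, a ≤ i ∧ b ≤ j ∧ 𝔗.NoCarry a b ∧ (𝔗.flagType i j : ℕ) ≤ a + b := by
  obtain ⟨a, ha, b, hb, hab⟩ := 𝔗.exists_elt_eq_mul i j
  obtain ⟨a', b', ha', hb', hnc, hk⟩ := 𝔗.exists_noCarry_aux (a := a) (b := b)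
    (k := 𝔗.flagType i j) 𝔗.length (by
      intro r hr
      have h1 := congrFun hab ⟨r, hr⟩
      rw [Pi.mul_apply, elt_apply, elt_apply, elt_apply, ← ofAdd_add, ← Nat.cast_add] at h1
      have h2 := (ZMod.natCast_eq_natCast_iff' _ _ _).1 (Multiplicative.ofAdd.injective h1)
      rw [Nat.mod_eq_of_lt (𝔗.digit_lt (𝔗.flagType i j) _)] at h2
      rw [digit_eq, digit_eq, digit_eq, ← natEntry_of_lt] at h2
      exact h2.symm)
  refine ⟨a', b', ?_, ?_, fun s => ?_, ?_⟩
  · exact ha'.trans ((Nat.mod_le _ _).trans ha)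
  · exact hb'.trans ((Nat.mod_le _ _).trans hb)
  · rcases le_total s 𝔗.length with h | h
    · exact hnc s h
    · have : 𝔗.partialDegree s = 𝔗.partialDegree 𝔗.length := by
        refine (Finset.prod_subset (Finset.range_mono h) fun r _ hr => ?_).symm
        rw [Finset.mem_range] at hr
        exact dif_neg hr
      rw [this]
      exact hnc _ le_rfl
  · rwa [partialDegree_length, Nat.mod_eq_of_lt (𝔗.flagType i j).2] at hk

theorem NoCarry.add_lt {𝔗 : TowerType} {i j : ℕ} (h : 𝔗.NoCarry i j) (hi : i < 𝔗.degree)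
    (hj : j < 𝔗.degree) : i + j < 𝔗.degree := by
  have := h 𝔗.length
  rwa [partialDegree_length, Nat.mod_eq_of_lt hi, Nat.mod_eq_of_lt hj] at this

/-- If `T(i,j) ≥ i + j` whenever no carry occurs, then `P_T ⊆ Len(𝔗)`. -/
theorem polyhedron_subset_Len {T : Fin 𝔗.degree → Fin 𝔗.degree → Fin 𝔗.degree}
    (hT : ∀ i j : Fin 𝔗.degree, 1 ≤ (i : ℕ) → 1 ≤ (j : ℕ) → 𝔗.NoCarry i j →
      (i : ℕ) + j ≤ T i j) : polyhedron T ⊆ Len 𝔗 := by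
  rintro x ⟨h0, hmono, hx⟩
  refine ⟨h0, hmono, fun a b c i j hi hj hc => ?_⟩
  obtain ⟨a', b', ha, hb, hnc, hk⟩ := 𝔗.exists_noCarry i j
  change (𝔗.flagType i j : ℕ) = c + 1 at hc
  -- The inequalities defining the polyhedron need positive indices. When a' or b' is 0,
  -- monotonicity and nonnegativity suffice.
  rcases Nat.eq_zero_or_pos a' with rfl | ha0
  · have := hmono (show c ≤ b from Fin.le_def.2 (by omega))
    linarith [h0 a]
  rcases Nat.eq_zero_or_pos b' with rfl | hb0
  · have := hmono (show c ≤ a from Fin.le_def.2 (by omega))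
    linarith [h0 b]
  have hi2 := i.2
  have hj2 := j.2
  set i' : Fin 𝔗.degree := ⟨a', by omega⟩ with hi'
  set j' : Fin 𝔗.degree := ⟨b', by omega⟩ with hj'
  have h1 : a' + b' ≤ T i' j' := hT i' j' ha0 hb0 hnc
  have h2 := (T i' j').2
  have h3 := hx ⟨a' - 1, by omega⟩ ⟨b' - 1, by omega⟩ ⟨(T i' j' : ℕ) - 1, by omega⟩ i' j'
    (Nat.sub_add_cancel ha0).symm (Nat.sub_add_cancel hb0).symm
    (Nat.sub_add_cancel (by omega)).symm
  have h4 := hmono (show c ≤ ⟨(T i' j' : ℕ) - 1, by omega⟩ from Fin.le_def.2 (by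
    change (c : ℕ) ≤ (T i' j' : ℕ) - 1; omega))
  have h5 := hmono (show (⟨a' - 1, by omega⟩ : Fin (𝔗.degree - 1)) ≤ a from Fin.le_def.2 (by
    change a' - 1 ≤ (a : ℕ); omega))
  have h6 := hmono (show (⟨b' - 1, by omega⟩ : Fin (𝔗.degree - 1)) ≤ b from Fin.le_def.2 (by
    change b' - 1 ≤ (b : ℕ); omega))
  linarith

end TowerType

/-! ### Arithmetic of a hypothetical defect -/

open LinearKneser Module

namespace TowerType

variable {𝔗 : TowerType}

/-- The numerical consequences of `T(i,j) < i + j` supplied by Kneser's theorem, where `m` is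
the degree of the stabiliser. -/
structure Defect (𝔗 : TowerType) (i j m α β : ℕ) : Prop where
  dvd : m ∣ 𝔗.degree
  lt_left : i < m * α
  lt_right : j < m * β
  mul_le : m * (α + β) ≤ i + j + m
  -- α stands for the dimension of H F_i over the stabiliser H. If it is at most 1, then F_i ≤ H, so
  -- H contains the tower field generated by F_i.
  left : α ≤ 1 → ∀ s < 𝔗.length, 𝔗.partialDegree s ≤ i → 𝔗.partialDegree (s + 1) ∣ m
  right : β ≤ 1 → ∀ s < 𝔗.length, 𝔗.partialDegree s ≤ j → 𝔗.partialDegree (s + 1) ∣ m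

namespace Defect

variable {i j m α β : ℕ}

/-- Since α ≥ ⌊i/m⌋ + 1 and β ≥ ⌊j/m⌋ + 1, the bound on m(α + β) leaves at least m for the two
remainders. For m a partial product this is a carry. -/
theorem le_mod_add_mod (h : 𝔗.Defect i j m α β) : m ≤ i % m + j % m := by
  have h1 := h.mul_le
  have hα : i / m < α := Nat.div_lt_of_lt_mul h.lt_left
  have hβ : j / m < β := Nat.div_lt_of_lt_mul h.lt_right
  have h2 : m * (i / m + j / m + 2) ≤ m * (α + β) := Nat.mul_le_mul_left _ (by omega)
  have h3 : m * (i / m + j / m + 2) = m * (i / m) + m * (j / m) + m + m := by ring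
  have h4 := Nat.div_add_mod i m
  have h5 := Nat.div_add_mod j m
  omega

theorem ne_partialDegree (h : 𝔗.Defect i j m α β) (hnc : 𝔗.NoCarry i j) (s : ℕ) :
    m ≠ 𝔗.partialDegree s := by
  rintro rfl
  exact absurd (hnc s) (not_lt.2 h.le_mod_add_mod)

theorem two_le (h : 𝔗.Defect i j m α β) (hi : 1 ≤ i) (hj : 1 ≤ j)
    (hm : ¬ 𝔗.partialDegree 1 ∣ m) : 2 ≤ α ∧ 2 ≤ β := by
  constructor
  · by_contra hc
    exact hm (h.left (by omega) 0 𝔗.length_pos hi)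
  · by_contra hc
    exact hm (h.right (by omega) 0 𝔗.length_pos hj)

theorem three_mul_lt (h : 𝔗.Defect i j m α β) (hi : 1 ≤ i) (hj : 1 ≤ j)
    (hij : i + j < 𝔗.degree) (hm : ¬ 𝔗.partialDegree 1 ∣ m) : 3 * m < 𝔗.degree := by
  obtain ⟨hα, hβ⟩ := h.two_le hi hj hm
  have h1 := h.mul_le
  have h2 : m * 4 ≤ m * (α + β) := Nat.mul_le_mul_left _ (by omega)
  omega

end Defect

theorem partialDegree_one : 𝔗.partialDegree 1 = 𝔗.natEntry 0 := by
  rw [partialDegree_succ, partialDegree_zero, one_mul]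

theorem two_le_natEntry {s : ℕ} (h : s < 𝔗.length) : 2 ≤ 𝔗.natEntry s := by
  rw [natEntry_of_lt _ h]; exact 𝔗.one_lt _

theorem partialDegree_dvd_degree {s : ℕ} (h : s ≤ 𝔗.length) : 𝔗.partialDegree s ∣ 𝔗.degree :=
  𝔗.partialDegree_length ▸ 𝔗.partialDegree_dvd h

theorem toList_eq_singleton (h : 𝔗.partialDegree 1 = 𝔗.degree) : 𝔗.toList = [𝔗.degree] := by
  have hl : 𝔗.length = 1 := by
    by_contra hne
    have h2 : 1 < 𝔗.length := lt_of_le_of_ne 𝔗.length_pos (Ne.symm hne)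
    have h3 : 𝔗.partialDegree 1 < 𝔗.partialDegree 2 := 𝔗.partialDegree_lt_succ h2
    have h4 := Nat.le_of_dvd 𝔗.degree_pos (𝔗.partialDegree_dvd_degree (s := 2) h2)
    omega
  rw [← h, partialDegree_one, natEntry_of_lt _ 𝔗.length_pos, toList]
  obtain ⟨t, ht, e, he⟩ := 𝔗
  subst hl
  rfl

/-- Among the divisors of qp only m = p ≠ q is not a partial product. As q does not divide p, both
dimensions over H are at least 2, so 3p < qp, which is impossible for q ≤ 3. -/
theorem not_defect_of_two_entries {q p : ℕ} (hq : q.Prime) (hq3 : q ≤ 3) (hp : p.Prime)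
    (hl : 𝔗.toList = [q, p]) {i j m α β : ℕ} (hi : 1 ≤ i) (hj : 1 ≤ j)
    (hij : i + j < 𝔗.degree) (hnc : 𝔗.NoCarry i j) : ¬ 𝔗.Defect i j m α β := by
  intro h
  have hl1 : 𝔗.partialDegree 1 = q ∧ 𝔗.degree = q * p := by
    rw [partialDegree_one, natEntry_of_lt _ 𝔗.length_pos]
    obtain ⟨t, ht, e, he⟩ := 𝔗
    have ht2 : t = 2 := by simpa [toList] using congrArg List.length hl
    subst ht2
    simp only [toList, List.ofFn_succ, List.ofFn_zero, List.cons.injEq] at hl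
    rw [degree]
    simp only [Fin.prod_univ_two]
    exact ⟨hl.1, by rw [← hl.1, ← hl.2.1]; rfl⟩
  obtain ⟨h1, hd⟩ := hl1
  have hne : ∀ s, m ≠ 𝔗.partialDegree s := h.ne_partialDegree hnc
  have hm1 : m ≠ 1 := hne 0
  have hmq : m ≠ q := h1 ▸ hne 1
  have hmn : m ≠ q * p := by rw [← hd, ← partialDegree_length]; exact hne _
  have hmp : m = p := by
    have hdvd : m ∣ q * p := hd ▸ h.dvd
    by_cases hqm : q ∣ m
    · obtain ⟨c, rfl⟩ := hqm
      have hc : c ∣ p := Nat.dvd_of_mul_dvd_mul_left hq.pos hdvd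
      rcases (Nat.dvd_prime hp).1 hc with rfl | rfl
      · simp at hmq
      · exact absurd rfl hmn
    · have hc : m.Coprime q := ((Nat.Prime.coprime_iff_not_dvd hq).2 hqm).symm
      exact ((Nat.dvd_prime hp).1 (hc.dvd_of_dvd_mul_left hdvd)).resolve_left hm1
  subst hmp
  have h3 := h.three_mul_lt hi hj hij (by
    rw [h1, Nat.prime_dvd_prime_iff_eq hq hp]; exact hmq.symm)
  rw [hd] at h3
  have := Nat.mul_le_mul_right m hq3
  omega

/-- Every divisor of a power of p is a partial product. -/
theorem not_defect_of_constant {p : ℕ} (hp : p.Prime) (hl : ∀ s, 𝔗.entry s = p)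
    {i j m α β : ℕ} (hnc : 𝔗.NoCarry i j) : ¬ 𝔗.Defect i j m α β := by
  intro h
  have hpow : ∀ s ≤ 𝔗.length, 𝔗.partialDegree s = p ^ s := by
    intro s hs
    rw [partialDegree, ← Finset.card_range s, ← Finset.prod_const, Finset.card_range]
    refine Finset.prod_congr rfl fun r hr => ?_
    rw [Finset.mem_range] at hr
    rw [natEntry_of_lt _ (by omega), hl]
  have hd := h.dvd
  rw [← partialDegree_length, hpow _ le_rfl, Nat.dvd_prime_pow hp] at hd
  obtain ⟨s, hs, rfl⟩ := hd
  exact h.ne_partialDegree hnc s (hpow s hs).symm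

theorem not_defect_of_small (h8 : 𝔗.degree < 8 ∨ 𝔗.degree = 8 ∧ 𝔗.toList ≠ [8])
    {i j m α β : ℕ} (hi : 1 ≤ i) (hj : 1 ≤ j)
    (hij : i + j < 𝔗.degree) (hnc : 𝔗.NoCarry i j) : ¬ 𝔗.Defect i j m α β := by
  intro h
  have hne : ∀ s, m ≠ 𝔗.partialDegree s := h.ne_partialDegree hnc
  have hm1 : m ≠ 1 := hne 0
  have hmn : m ≠ 𝔗.degree := by rw [← partialDegree_length]; exact hne _
  have hmM := hne 1
  have hMd : 𝔗.partialDegree 1 ∣ 𝔗.degree := 𝔗.partialDegree_dvd_degree 𝔗.length_pos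
  have hM2 : 2 ≤ 𝔗.partialDegree 1 := by
    rw [partialDegree_one]; exact two_le_natEntry 𝔗.length_pos
  have hdvd := h.dvd
  have hmpos : 0 < m := Nat.pos_of_dvd_of_pos hdvd 𝔗.degree_pos
  obtain ⟨c, hc⟩ := hdvd
  -- If n₁ divides m, properly since m ≠ n₁, then n₁ = 2, m = 4, n = 8, and 𝔗 = (2, 4). The bounds
  -- force α, β ≤ 1, so i, j < 2 and i + j cannot reach m.
  by_cases hMm : 𝔗.partialDegree 1 ∣ m
  · obtain ⟨d, hd⟩ := hMm
    have hd2 : 2 ≤ d := by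
      rcases Nat.lt_or_ge d 2 with hd' | hd'
      · interval_cases d <;> omega
      · exact hd'
    have hc2 : 2 ≤ c := by
      rcases Nat.lt_or_ge c 2 with hc' | hc'
      · interval_cases c <;> omega
      · exact hc'
    have hm4 : 4 ≤ m := by
      rw [hd]; exact Nat.mul_le_mul hM2 hd2
    have hm8 : 8 ≤ 𝔗.degree := by rw [hc]; exact Nat.mul_le_mul hm4 hc2
    have hdeg : 𝔗.degree = 8 := by omega
    have hm : m = 4 := by
      have h1 : m * 2 ≤ m * c := Nat.mul_le_mul_left _ hc2
      omega
    have hM : 𝔗.partialDegree 1 = 2 := by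
      have h1 : 𝔗.partialDegree 1 * 2 ≤ 𝔗.partialDegree 1 * d := Nat.mul_le_mul_left _ hd2
      omega
    have hlen : 1 < 𝔗.length := by
      by_contra hl
      have : 𝔗.length = 1 := le_antisymm (not_lt.1 hl) 𝔗.length_pos
      have h2 := 𝔗.partialDegree_length
      rw [this] at h2
      omega
    have hd3 : 𝔗.partialDegree 2 ∣ 8 := hdeg ▸ 𝔗.partialDegree_dvd_degree hlen
    have hgt : 𝔗.partialDegree 1 < 𝔗.partialDegree 2 := 𝔗.partialDegree_lt_succ hlen
    have hle := Nat.le_of_dvd (by norm_num) hd3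
    have hM4 := hne 2
    have hn : ¬ 𝔗.partialDegree 2 ∣ 4 := by
      intro h4
      have := Nat.le_of_dvd (by norm_num) h4
      have h5 : 𝔗.partialDegree 2 = 3 := by omega
      rw [h5] at h4
      norm_num at h4
    subst hm
    have h1 := h.mul_le
    have h2 := h.lt_left
    have h3 := h.lt_right
    have hi1 : α ≤ 1 → i < 2 := fun hα => by
      by_contra hi2
      exact hn (h.left hα 1 hlen (by omega))
    have hj1 : β ≤ 1 → j < 2 := fun hβ => by
      by_contra hj2
      exact hn (h.right hβ 1 hlen (by omega))
    have := h.le_mod_add_mod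
    omega
  -- If n₁ does not divide m, then 3m < n leaves m = 2 and n = 8, and excluding (8) leaves n₁ = 4.
  -- The bounds give α = β = 2, so i, j < 4 and i + j ≥ 6, a carry modulo 4.
  · have h3 := h.three_mul_lt hi hj hij hMm
    obtain ⟨hα, hβ⟩ := h.two_le hi hj hMm
    have hm2 : m = 2 := by omega
    subst hm2
    have hdeg : 𝔗.degree = 8 := by omega
    have hle := Nat.le_of_dvd 𝔗.degree_pos hMd
    have hM8 : 𝔗.partialDegree 1 ≠ 8 := by
      intro h8'
      refine (h8.resolve_left (by omega)).2 ?_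
      rw [toList_eq_singleton (h8'.trans hdeg.symm), hdeg]
    have hM4 : 𝔗.partialDegree 1 = 4 := by
      rw [hdeg] at hMd hle
      generalize 𝔗.partialDegree 1 = M at *
      interval_cases M <;> first | rfl | omega
    have hnc1 := hnc 1
    rw [hM4] at hnc1
    have h1 := h.mul_le
    have h2 := h.lt_left
    have h3 := h.lt_right
    have := h.le_mod_add_mod
    omega

theorem not_defect (h : 𝔗.degree < 8 ∨
      (𝔗.degree = 8 ∧ 𝔗.toList ≠ [8]) ∨
      𝔗.degree.Prime ∨
      (∃ p : ℕ, p.Prime ∧ ∀ s, 𝔗.entry s = p) ∨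
      (∃ p : ℕ, p.Prime ∧ 𝔗.toList = [2, p]) ∨
      (∃ p : ℕ, p.Prime ∧ 𝔗.toList = [3, p]))
    {i j m α β : ℕ} (hi : 1 ≤ i) (hj : 1 ≤ j)
    (hij : i + j < 𝔗.degree) (hnc : 𝔗.NoCarry i j) : ¬ 𝔗.Defect i j m α β := by
  rcases h with h | h | h | ⟨p, hp, h⟩ | ⟨p, hp, h⟩ | ⟨p, hp, h⟩
  · exact not_defect_of_small (Or.inl h) hi hj hij hnc
  · exact not_defect_of_small (Or.inr h) hi hj hij hnc
  · intro hd
    rcases (Nat.dvd_prime h).1 hd.dvd with hm | hm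
    · exact hd.ne_partialDegree hnc 0 hm
    · exact hd.ne_partialDegree hnc 𝔗.length (hm.trans 𝔗.partialDegree_length.symm)
  · exact not_defect_of_constant hp h hnc
  · exact not_defect_of_two_entries Nat.prime_two (by norm_num) hp h hi hj hij hnc
  · exact not_defect_of_two_entries Nat.prime_three le_rfl hp h hi hj hij hnc

end TowerType

/-! ### From Kneser's theorem to flags of field extensions -/

namespace FieldFlag

variable {K : Type u} {L : Type v} [Field K] [Field L] [Algebra K L] [FiniteDimensional K L]
  {𝔗 : TowerType} (F : FieldFlag K L 𝔗.degree)

theorem one_mem (i : Fin 𝔗.degree) : (1 : L) ∈ F.toSubmodule i := by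
  have h0 := F.first ⟨0, 𝔗.degree_pos⟩ rfl
  have : F.toSubmodule ⟨0, 𝔗.degree_pos⟩ ≤ F.toSubmodule i :=
    F.strictMono.monotone (Fin.le_def.2 (Nat.zero_le _))
  exact this (h0 ▸ Submodule.one_le.1 le_rfl)

/-- F_i has dimension i + 1 > [L_s : K], so the tower field that it generates lies strictly above
L_s, and H contains L_{s+1}. -/
theorem partialDegree_dvd_finrank (h : F.HasTowerType 𝔗) {i : Fin 𝔗.degree} {s : ℕ}
    (hs : s < 𝔗.length) (hi : 𝔗.partialDegree s ≤ i) {H : IntermediateField K L}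
    (hH : F.toSubmodule i ≤ fieldSpace H) : 𝔗.partialDegree (s + 1) ∣ finrank K H := by
  obtain ⟨E, hmono, h0, -, hgen, hrel⟩ := h
  have hE : ∀ s : ℕ, ∀ hs : s < 𝔗.length + 1, finrank K (E ⟨s, hs⟩) = 𝔗.partialDegree s := by
    intro s
    induction s with
    | zero =>
      intro hs
      rw [show (⟨0, hs⟩ : Fin (𝔗.length + 1)) = 0 from rfl, h0, IntermediateField.finrank_bot]
      rfl
    | succ s ih =>
      intro hs
      have hs' : s < 𝔗.length := by omega
      have h1 := hrel ⟨s, hs'⟩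
      have h2 := IntermediateField.finrank_bot_mul_relfinrank
        (hmono.monotone (Fin.castSucc_le_succ (⟨s, hs'⟩ : Fin 𝔗.length)))
      rw [h1] at h2
      have h3 := ih (by omega)
      rw [TowerType.partialDegree_succ, TowerType.natEntry_of_lt _ hs', ← h3]
      exact h2.symm
  obtain ⟨r, hr⟩ := (hgen _).2 ⟨i, rfl⟩
  have hlt : s + 1 ≤ (r : ℕ) := by
    by_contra hc
    have h1 : F.toSubmodule i ≤ fieldSpace (E r) := by
      rw [hr]; exact IntermediateField.subset_adjoin K _
    have h2 := Submodule.finrank_mono h1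
    rw [F.finrank_toSubmodule] at h2
    have h3 : finrank K (fieldSpace (E r)) = 𝔗.partialDegree r := hE r r.2
    have h4 := Nat.le_of_dvd (𝔗.partialDegree_pos s) (𝔗.partialDegree_dvd (r := r) (by omega))
    omega
  have hle : E ⟨s + 1, by omega⟩ ≤ H := by
    refine (hmono.monotone (Fin.le_def.2 hlt)).trans ?_
    rw [hr, IntermediateField.adjoin_le_iff]
    exact hH
  rw [← hE (s + 1) (by omega), ← IntermediateField.finrank_bot_mul_relfinrank hle]
  exact Dvd.intro _ rfl

theorem exists_defect (h : F.HasTowerType 𝔗) {i j : Fin 𝔗.degree}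
    (hij : (F.flagType i j : ℕ) < i + j) : ∃ m α β, 𝔗.Defect i j m α β := by
  obtain ⟨H, α, β, h1, h2, h3, h4, h5⟩ := exists_dims_of_mul (F.one_mem i) (F.one_mem j)
  rw [F.finrank_toSubmodule] at h1 h2
  have hle : F.toSubmodule i * F.toSubmodule j ≤ F.toSubmodule (F.flagType i j) :=
    leastIndex_spec _ (F.exists_mul_le i j)
  -- Thus dim F_i F_j ≤ T(i,j) + 1 ≤ i + j, whereas dim F_i + dim F_j - 1 = i + j + 1.
  have hle' := Submodule.finrank_mono hle
  rw [F.finrank_toSubmodule] at hle'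
  refine ⟨finrank K H, α, β, ?_, h1, h2, by omega, fun hα s hs hi => ?_, fun hβ s hs hj => ?_⟩
  · rw [← F.finrank_field, ← finrank_mul_finrank K H L]
    exact Dvd.intro _ rfl
  · exact F.partialDegree_dvd_finrank h hs hi (h4 hα)
  · exact F.partialDegree_dvd_finrank h hs hj (h5 hβ)

theorem add_le_flagType (hT : F.HasTowerType 𝔗) (h : 𝔗.degree < 8 ∨
      (𝔗.degree = 8 ∧ 𝔗.toList ≠ [8]) ∨
      𝔗.degree.Prime ∨
      (∃ p : ℕ, p.Prime ∧ ∀ s, 𝔗.entry s = p) ∨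
      (∃ p : ℕ, p.Prime ∧ 𝔗.toList = [2, p]) ∨
      (∃ p : ℕ, p.Prime ∧ 𝔗.toList = [3, p]))
    (i j : Fin 𝔗.degree) (hi : 1 ≤ (i : ℕ)) (hj : 1 ≤ (j : ℕ)) (hnc : 𝔗.NoCarry i j) :
    (i : ℕ) + j ≤ F.flagType i j := by
  by_contra hc
  obtain ⟨m, α, β, hd⟩ := F.exists_defect hT (not_le.1 hc)
  exact TowerType.not_defect h hi hj (hnc.add_lt i.2 j.2) hnc hd

end FieldFlag

/-! ### A field extension graded by a given finite abelian group -/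

section GradedField

variable (G : Type u) [CommGroup G] [Finite G]

/-- A character of `G` acts on polynomials in the elements of `G` by scaling the variables. -/
noncomputable def scaleVariables : (G →* ℂˣ) →* (MvPolynomial G ℂ →ₐ[ℂ] MvPolynomial G ℂ) where
  toFun χ := MvPolynomial.aeval fun g => MvPolynomial.C (χ g : ℂ) * MvPolynomial.X g
  map_one' := by ext g; simp
  map_mul' χ ψ := by
    ext1 g
    simp only [MvPolynomial.aeval_X, MonoidHom.mul_apply, Units.val_mul, map_mul,
      AlgHom.mul_apply, MvPolynomial.algHom_C, MvPolynomial.algebraMap_eq]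
    ring

/-- The action of the characters of `G` on rational functions in the elements of `G`. -/
noncomputable def scaleFraction :
    (G →* ℂˣ) →* (FractionRing (MvPolynomial G ℂ) ≃ₐ[ℂ] FractionRing (MvPolynomial G ℂ)) :=
  (IsFractionRing.fieldEquivOfAlgEquivHom ℂ (FractionRing (MvPolynomial G ℂ))).comp
    ((AlgEquiv.algHomUnitsEquiv ℂ (MvPolynomial G ℂ)).toMonoidHom.comp
      (scaleVariables G).toHomUnits)

/-- The variable attached to `g`, as a rational function. -/
noncomputable def fractionVar (g : G) : FractionRing (MvPolynomial G ℂ) :=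
  algebraMap (MvPolynomial G ℂ) _ (MvPolynomial.X g)

theorem fractionVar_ne_zero (g : G) : fractionVar G g ≠ 0 := by
  rw [fractionVar, Ne, FaithfulSMul.algebraMap_eq_zero_iff]
  exact MvPolynomial.X_ne_zero g

theorem scaleFraction_fractionVar (χ : G →* ℂˣ) (g : G) :
    scaleFraction G χ (fractionVar G g) =
      algebraMap ℂ (FractionRing (MvPolynomial G ℂ)) (χ g) * fractionVar G g := by
  have h1 : scaleFraction G χ (fractionVar G g) =
      algebraMap (MvPolynomial G ℂ) _ (scaleVariables G χ (MvPolynomial.X g)) :=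
    IsFractionRing.fieldEquivOfAlgEquiv_algebraMap _ _ _ _ _
  have h2 : scaleVariables G χ (MvPolynomial.X g) =
      algebraMap ℂ (MvPolynomial G ℂ) (χ g) * MvPolynomial.X g := MvPolynomial.aeval_X _ g
  rw [h1, h2, map_mul, ← IsScalarTower.algebraMap_apply]
  rfl

/-- Every finite abelian group `G` grades a field extension by one-dimensional pieces. -/
theorem exists_graded_field : ∃ (K L : Type u) (_ : Field K) (_ : Field L) (_ : Algebra K L)
    (_ : FiniteDimensional K L) (x : G → L), (∀ g, x g ≠ 0) ∧ LinearIndependent K x ∧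
      finrank K L = Nat.card G ∧ ∀ g h, ∃ c : K, x g * x h = c • x (g * h) := by
  -- L is the field of rational functions in variables X_g, and K is the fixed field of the dual
  -- group acting by X_g ↦ χ(g) X_g.
  let : MulSemiringAction (G →* ℂˣ) (FractionRing (MvPolynomial G ℂ)) :=
    MulSemiringAction.compHom _ (scaleFraction G)
  have hsmul : ∀ (χ : G →* ℂˣ) (y : FractionRing (MvPolynomial G ℂ)),
    χ • y = scaleFraction G χ y := fun _ _ => rfl
  have hcard := CommGroup.card_monoidHom_of_hasEnoughRootsOfUnity G ℂ
  have : Finite (G →* ℂˣ) := Nat.finite_of_card_ne_zero (hcard ▸ Nat.card_pos.ne')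
  have := Fintype.ofFinite G
  have := Fintype.ofFinite (G →* ℂˣ)
  have hli : LinearIndependent (FixedPoints.subfield (G →* ℂˣ) (FractionRing (MvPolynomial G ℂ)))
      (fractionVar G) := by
    rw [Fintype.linearIndependent_iff]
    intro c hc g
    -- X_g is an eigenvector with eigencharacter χ ↦ χ(g). These characters are distinct for
    -- distinct g, so Dedekind independence applies to the coefficients c_g X_g.
    let φ : G → ((G →* ℂˣ) →* FractionRing (MvPolynomial G ℂ)) := fun g =>
      { toFun := fun χ => algebraMap ℂ _ (χ g : ℂ)
        map_one' := by simp
        map_mul' := fun χ ψ => by simp }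
    have hφ : Function.Injective φ := by
      intro g h hgh
      refine (CommGroup.forall_apply_eq_apply_iff G (M := ℂ)).1 fun χ => ?_
      have := DFunLike.congr_fun hgh χ
      exact Units.ext ((algebraMap ℂ (FractionRing (MvPolynomial G ℂ))).injective this)
    have hind := (linearIndependent_monoidHom (G →* ℂˣ)
      (FractionRing (MvPolynomial G ℂ))).comp φ hφ
    rw [Fintype.linearIndependent_iff] at hind
    have := hind (fun g => c g * fractionVar G g) (by
      ext χ
      have h := congrArg (scaleFraction G χ) hc
      rw [map_sum, map_zero] at h
      simp only [Finset.sum_apply, Pi.smul_apply, Function.comp_apply, smul_eq_mul,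
        Pi.zero_apply]
      rw [← h]
      refine Finset.sum_congr rfl fun g _ => ?_
      rw [Subfield.smul_def, smul_eq_mul, map_mul, ← hsmul χ (c g), (c g).2 χ,
        scaleFraction_fractionVar]
      simp only [φ, MonoidHom.coe_mk, OneHom.coe_mk]
      ring) g
    have h0 := (mul_eq_zero.1 this).resolve_right (fractionVar_ne_zero G g)
    exact Subtype.ext h0
  refine ⟨FixedPoints.subfield (G →* ℂˣ) (FractionRing (MvPolynomial G ℂ)),
    FractionRing (MvPolynomial G ℂ), inferInstance, inferInstance, inferInstance, inferInstance,
    fractionVar G, fractionVar_ne_zero G, hli, le_antisymm ?_ ?_, fun g h => ?_⟩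
  · rw [← hcard, Nat.card_eq_fintype_card]
    exact FixedPoints.finrank_le_card _ _
  · rw [Nat.card_eq_fintype_card]
    exact hli.fintype_card_le_finrank
  · have hgh := fractionVar_ne_zero G (g * h)
    -- The characters cancel in X_g X_h / X_{gh}, so this quotient lies in K.
    refine ⟨⟨fractionVar G g * fractionVar G h / fractionVar G (g * h), fun χ => ?_⟩, ?_⟩
    · rw [hsmul, map_div₀, map_mul, scaleFraction_fractionVar, scaleFraction_fractionVar,
        scaleFraction_fractionVar, map_mul, Units.val_mul, map_mul]
      have h1 : algebraMap ℂ (FractionRing (MvPolynomial G ℂ)) (χ g) ≠ 0 := by simp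
      have h2 : algebraMap ℂ (FractionRing (MvPolynomial G ℂ)) (χ h) ≠ 0 := by simp
      field_simp
    · rw [Subfield.smul_def, smul_eq_mul, div_mul_cancel₀ _ hgh]

end GradedField

/-! ### Graded bases: from flags of groups to flags of fields -/

theorem leastIndex_congr {n : ℕ} {p q : Fin n → Prop} (hp : ∃ k, p k) (hq : ∃ k, q k)
    (h : ∀ k, p k ↔ q k) : leastIndex p hp = leastIndex q hq := by
  have : p = q := funext fun k => propext (h k)
  subst this
  rfl

/-- A basis of a field extension indexed by a finite abelian group and multiplicative up to
scalars. -/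
structure GradedBasis (G K L : Type*) [CommGroup G] [Finite G] [Field K] [Field L] [Algebra K L]
    [FiniteDimensional K L] where
  toFun : G → L
  ne_zero : ∀ g, toFun g ≠ 0
  linearIndependent : LinearIndependent K toFun
  finrank_eq : finrank K L = Nat.card G
  exists_smul : ∀ g h, ∃ c : K, toFun g * toFun h = c • toFun (g * h)

namespace GradedBasis

variable {G : Type*} {K : Type u} {L : Type v} [CommGroup G] [Finite G] [Field K] [Field L]
  [Algebra K L] [FiniteDimensional K L] (x : GradedBasis G K L)

/-- The span of the basis elements with index in a given set. -/
def piece (A : Set G) : Submodule K L := Submodule.span K (x.toFun '' A)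

theorem mem_piece {A : Set G} {g : G} (h : g ∈ A) : x.toFun g ∈ x.piece A :=
  Submodule.subset_span (Set.mem_image_of_mem _ h)

theorem finrank_piece (A : Set G) : finrank K (x.piece A) = A.ncard := by
  have := Fintype.ofFinite A
  have h := finrank_span_eq_card (x.linearIndependent.comp ((↑) : A → G) Subtype.val_injective)
  rw [Set.range_comp, Subtype.range_coe] at h
  rw [piece, h, ← Nat.card_coe_set_eq, Nat.card_eq_fintype_card]

theorem piece_le_piece {A B : Set G} : x.piece A ≤ x.piece B ↔ A ⊆ B := by
  refine ⟨fun h g hg => ?_, fun h => Submodule.span_mono (Set.image_mono h)⟩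
  by_contra hB
  exact x.linearIndependent.notMem_span_image hB (h (x.mem_piece hg))

theorem exists_ne_zero (g h : G) :
    ∃ c : K, c ≠ 0 ∧ x.toFun g * x.toFun h = c • x.toFun (g * h) := by
  obtain ⟨c, hc⟩ := x.exists_smul g h
  refine ⟨c, ?_, hc⟩
  rintro rfl
  rw [zero_smul] at hc
  exact mul_ne_zero (x.ne_zero g) (x.ne_zero h) hc

/-- L has no zero divisors, so the structure constants are nonzero and each x_{ab} is recovered from
x_a x_b. -/
theorem piece_mul (A B : Set G) : x.piece A * x.piece B = x.piece (A * B) := by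
  rw [piece, piece, Submodule.span_mul_span]
  refine le_antisymm (Submodule.span_le.2 ?_) (Submodule.span_le.2 ?_)
  · rintro _ ⟨_, ⟨a, ha, rfl⟩, _, ⟨b, hb, rfl⟩, rfl⟩
    obtain ⟨c, hc⟩ := x.exists_smul a b
    change x.toFun a * x.toFun b ∈ x.piece (A * B)
    rw [hc]
    exact Submodule.smul_mem _ _ (x.mem_piece (Set.mul_mem_mul ha hb))
  · rintro _ ⟨_, ⟨a, ha, b, hb, rfl⟩, rfl⟩
    obtain ⟨c, hc0, hc⟩ := x.exists_ne_zero a b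
    have : x.toFun (a * b) = c⁻¹ • (x.toFun a * x.toFun b) := by
      rw [hc, smul_smul, inv_mul_cancel₀ hc0, one_smul]
    change x.toFun (a * b) ∈ _
    rw [this]
    exact Submodule.smul_mem _ _ (Submodule.subset_span
      (Set.mul_mem_mul (Set.mem_image_of_mem _ ha) (Set.mem_image_of_mem _ hb)))

theorem exists_algebraMap : ∃ c : K, c ≠ 0 ∧ x.toFun 1 = algebraMap K L c := by
  obtain ⟨c, hc0, hc⟩ := x.exists_ne_zero 1 1
  rw [mul_one, Algebra.smul_def] at hc
  exact ⟨c, hc0, mul_right_cancel₀ (x.ne_zero 1) hc⟩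

theorem piece_one : x.piece {1} = 1 := by
  obtain ⟨c, hc0, hc⟩ := x.exists_algebraMap
  rw [piece, Set.image_singleton, Submodule.one_eq_span, hc, Algebra.algebraMap_eq_smul_one]
  exact Submodule.span_singleton_smul_eq (IsUnit.mk0 c hc0) 1

theorem piece_univ : x.piece Set.univ = ⊤ := by
  refine Submodule.eq_top_of_finrank_eq ?_
  rw [finrank_piece, x.finrank_eq, Set.ncard_univ]

/-- The subfield spanned by the basis elements with index in a given subgroup. -/
def subfield (H : Subgroup G) : IntermediateField K L := commonStabilizer {x.piece H}

theorem one_mem_piece (H : Subgroup G) : (1 : L) ∈ x.piece H := by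
  have : x.piece {1} ≤ x.piece H := x.piece_le_piece.2 (Set.singleton_subset_iff.2 H.one_mem)
  rw [piece_one] at this
  exact Submodule.one_le.1 this

theorem fieldSpace_subfield (H : Subgroup G) : fieldSpace (x.subfield H) = x.piece H := by
  refine le_antisymm ?_ fun y hy => ?_
  · exact (isStable_commonStabilizer (Set.mem_singleton _)).le (x.one_mem_piece H)
  · intro X hX z hz
    rw [Set.mem_singleton_iff] at hX
    subst hX
    have := Submodule.mul_mem_mul hy hz
    rwa [piece_mul, coe_mul_coe] at this

theorem subfield_le_subfield {H H' : Subgroup G} : x.subfield H ≤ x.subfield H' ↔ H ≤ H' := by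
  rw [← fieldSpace_le, fieldSpace_subfield, fieldSpace_subfield, piece_le_piece,
    SetLike.coe_subset_coe]

theorem subfield_strictMono : StrictMono x.subfield := fun _ _ h =>
  lt_of_le_not_ge (x.subfield_le_subfield.2 h.le) fun h' => h.not_ge (x.subfield_le_subfield.1 h')

theorem finrank_subfield (H : Subgroup G) : finrank K (x.subfield H) = Nat.card H := by
  change finrank K (fieldSpace (x.subfield H)) = _
  rw [fieldSpace_subfield, finrank_piece, ← Nat.card_coe_set_eq]
  rfl

theorem subfield_bot : x.subfield ⊥ = ⊥ := by
  refine fieldSpace_injective ?_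
  rw [fieldSpace_subfield, Subgroup.coe_bot, piece_one]
  ext y
  rw [mem_fieldSpace, IntermediateField.mem_bot, Submodule.mem_one]
  rfl

theorem subfield_top : x.subfield ⊤ = ⊤ := by
  refine fieldSpace_injective ?_
  rw [fieldSpace_subfield, Subgroup.coe_top, piece_univ]
  ext y
  simp

theorem adjoin_piece (A : Set G) :
    IntermediateField.adjoin K (x.piece A : Set L) = x.subfield (Subgroup.closure A) := by
  refine le_antisymm ?_ ?_
  · rw [IntermediateField.adjoin_le_iff]
    change x.piece A ≤ fieldSpace (x.subfield (Subgroup.closure A))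
    rw [fieldSpace_subfield, piece_le_piece]
    exact Subgroup.subset_closure
  · rw [← fieldSpace_le, fieldSpace_subfield, piece, Submodule.span_le]
    obtain ⟨c₁, -, hc₁⟩ := x.exists_algebraMap
    have aux : ∀ g h, x.toFun g * x.toFun h ∈ IntermediateField.adjoin K (x.piece A : Set L) →
        x.toFun (g * h) ∈ IntermediateField.adjoin K (x.piece A : Set L) := by
      intro g h hgh
      obtain ⟨c, hc0, hc⟩ := x.exists_ne_zero g h
      rw [hc] at hgh
      have := IntermediateField.smul_mem _ hgh (x := c⁻¹)
      rwa [smul_smul, inv_mul_cancel₀ hc0, one_smul] at this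
    rintro _ ⟨g, hg, rfl⟩
    induction hg using Subgroup.closure_induction with
    | mem g hg => exact IntermediateField.subset_adjoin K _ (x.mem_piece hg)
    | one => rw [hc₁]; exact IntermediateField.algebraMap_mem _ c₁
    | mul g h _ _ hg hh => exact aux g h (mul_mem hg hh)
    | inv g _ hg =>
      -- The product of the basis elements at g and g⁻¹ is a scalar, so the latter is a scalar
      -- multiple of the inverse of the former.
      obtain ⟨c, hc0, hc⟩ := x.exists_ne_zero g g⁻¹
      rw [mul_inv_cancel, hc₁, Algebra.smul_def, ← map_mul] at hc
      have : x.toFun g⁻¹ = (x.toFun g)⁻¹ * algebraMap K L (c * c₁) := by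
        rw [← hc, ← mul_assoc, inv_mul_cancel₀ (x.ne_zero g), one_mul]
      change x.toFun g⁻¹ ∈ IntermediateField.adjoin K (x.piece A : Set L)
      rw [this]
      exact mul_mem (inv_mem hg) (IntermediateField.algebraMap_mem _ _)

/-- The flag of a field extension spanned by a flag of a group. -/
def fieldFlag {n : ℕ} (F : GroupFlag G n) : FieldFlag K L n where
  toSubmodule i := x.piece (F.toSet i)
  finrank_field := x.finrank_eq.trans F.card_group
  strictMono := fun _ _ h => lt_of_le_not_ge (x.piece_le_piece.2 (F.strictMono h).1) fun h' =>
    (F.strictMono h).2 (x.piece_le_piece.1 h')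
  finrank_toSubmodule i := by rw [finrank_piece, F.card_toSet]
  first i hi := by rw [F.first i hi, piece_one]
  last i hi := by rw [F.last i hi, piece_univ]

theorem flagType_fieldFlag {n : ℕ} (F : GroupFlag G n) :
    (x.fieldFlag F).flagType = F.flagType := by
  funext i j
  refine leastIndex_congr _ _ fun k => ?_
  change x.piece _ * x.piece _ ≤ x.piece _ ↔ _
  rw [piece_mul, piece_le_piece]

theorem hasTowerType_fieldFlag {n : ℕ} {F : GroupFlag G n} {𝔗 : TowerType}
    (h : F.HasTowerType 𝔗) : (x.fieldFlag F).HasTowerType 𝔗 := by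
  obtain ⟨H, hmono, hbot, htop, hgen, hcard⟩ := h
  refine ⟨fun s => x.subfield (H s), x.subfield_strictMono.comp hmono, ?_, ?_, fun A => ?_,
    fun s => ?_⟩
  · simp only [hbot, subfield_bot]
  · simp only [htop, subfield_top]
  · constructor
    · rintro ⟨s, rfl⟩
      obtain ⟨i, hi⟩ := (hgen (H s)).1 ⟨s, rfl⟩
      exact ⟨i, (x.adjoin_piece _).trans (congrArg x.subfield hi)⟩
    · rintro ⟨i, rfl⟩
      obtain ⟨s, hs⟩ := (hgen _).2 ⟨i, rfl⟩
      exact ⟨s, (congrArg x.subfield hs).trans (x.adjoin_piece _).symm⟩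
  · have h1 := IntermediateField.finrank_bot_mul_relfinrank
      (x.subfield_le_subfield.2 (hmono.monotone (Fin.castSucc_le_succ s)))
    rw [finrank_subfield, finrank_subfield, hcard s, mul_comm] at h1
    exact Nat.eq_of_mul_eq_mul_right Nat.card_pos h1

end GradedBasis

theorem GroupFlag.exists_fieldFlag {G : Type u} [CommGroup G] [Finite G] {𝔗 : TowerType}
    (F : GroupFlag G 𝔗.degree) (hF : F.HasTowerType 𝔗) :
    ∃ (K L : Type u) (_ : Field K) (_ : Field L) (_ : Algebra K L) (_ : FiniteDimensional K L)
      (F' : FieldFlag K L 𝔗.degree), F'.HasTowerType 𝔗 ∧ F'.flagType = F.flagType := by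
  obtain ⟨K, L, _, _, _, _, x, h0, hli, hd, hs⟩ := exists_graded_field G
  let b : GradedBasis G K L := ⟨x, h0, hli, hd, hs⟩
  exact ⟨K, L, _, _, _, inferInstance, b.fieldFlag F, b.hasTowerType_fieldFlag hF,
    b.flagType_fieldFlag F⟩

/-! ### Transport of flags along group isomorphisms -/

namespace GroupFlag

variable {G G' : Type*} [CommGroup G] [Finite G] [CommGroup G'] [Finite G'] {n : ℕ}

/-- The image of a flag under an isomorphism. -/
def map (F : GroupFlag G n) (e : G ≃* G') : GroupFlag G' n where
  toSet i := e '' F.toSet i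
  card_group := (Nat.card_congr e.toEquiv).symm.trans F.card_group
  strictMono := fun _ _ h => e.injective.image_strictMono (F.strictMono h)
  card_toSet i := by rw [Set.ncard_image_of_injective _ e.injective, F.card_toSet]
  first i hi := by rw [F.first i hi, Set.image_singleton, map_one]
  last i hi := by rw [F.last i hi, Set.image_univ, e.surjective.range_eq]

theorem flagType_map (F : GroupFlag G n) (e : G ≃* G') : (F.map e).flagType = F.flagType := by
  funext i j
  refine leastIndex_congr _ _ fun k => ?_
  change e '' _ * e '' _ ⊆ e '' _ ↔ _
  rw [← Set.image_mul, Set.image_subset_image_iff e.injective]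

theorem HasTowerType.map {F : GroupFlag G n} {𝔗 : TowerType} (h : F.HasTowerType 𝔗)
    (e : G ≃* G') : (F.map e).HasTowerType 𝔗 := by
  obtain ⟨H, hmono, hbot, htop, hgen, hcard⟩ := h
  have hc : ∀ A : Set G, Subgroup.closure (e '' A) =
      (Subgroup.closure A).map (e : G →* G') := fun A =>
    (MonoidHom.map_closure (e : G →* G') A).symm
  have hk : ∀ A : Subgroup G, Nat.card (A.map (e : G →* G')) = Nat.card A := fun A =>
    (Nat.card_congr (A.equivMapOfInjective (e : G →* G') e.injective).toEquiv).symm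
  refine ⟨fun s => (H s).map (e : G →* G'), ?_, ?_, ?_, fun A => ?_, fun s => ?_⟩
  · intro s t hst
    exact lt_of_le_of_ne (Subgroup.map_mono (hmono hst).le) fun h' =>
      (hmono hst).ne (Subgroup.map_injective e.injective h')
  · simp only [hbot, Subgroup.map_bot]
  · simp only [htop]
    exact Subgroup.map_top_of_surjective _ e.surjective
  · constructor
    · rintro ⟨s, rfl⟩
      obtain ⟨i, hi⟩ := (hgen (H s)).1 ⟨s, rfl⟩
      exact ⟨i, (hc _).trans (congrArg _ hi)⟩
    · rintro ⟨i, rfl⟩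
      obtain ⟨s, hs⟩ := (hgen _).2 ⟨i, rfl⟩
      exact ⟨s, (congrArg _ hs).trans (hc _).symm⟩
  · simp only [hk]
    exact hcard s

end GroupFlag

/-! ### The tower type of the standard flag -/

namespace TowerType

variable (𝔗 : TowerType)

/-- The product of the first `s` factors of `C_{n₁} × ⋯ × C_{n_t}`. -/
def initialSubgroup (s : ℕ) : Subgroup 𝔗.CyclicProd where
  carrier := {g | ∀ r : Fin 𝔗.length, s ≤ r → g r = 1}
  one_mem' := fun _ _ => rfl
  mul_mem' := fun {a b} ha hb r hr => by rw [Pi.mul_apply, ha r hr, hb r hr, one_mul]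
  inv_mem' := fun {a} ha r hr => by rw [Pi.inv_apply, ha r hr, inv_one]

theorem elt_apply_eq_one_iff (a : Fin 𝔗.degree) (r : Fin 𝔗.length) :
    𝔗.elt a r = 1 ↔ 𝔗.digit a r = 0 := by
  rw [elt_apply, ofAdd_eq_one, ZMod.natCast_eq_zero_iff]
  exact ⟨fun h => Nat.eq_zero_of_dvd_of_lt h (𝔗.digit_lt a r), fun h => h ▸ dvd_zero _⟩

theorem elt_mem_initialSubgroup {a : Fin 𝔗.degree} {s : ℕ} (hs : s ≤ 𝔗.length) :
    𝔗.elt a ∈ 𝔗.initialSubgroup s ↔ (a : ℕ) < 𝔗.partialDegree s := by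
  constructor
  · intro h
    -- The digits of a in positions ≥ s vanish; the quotients are shown to be 0 from the top digit
    -- downwards.
    have key : ∀ k ≤ 𝔗.length - s, (a : ℕ) / 𝔗.partialDegree (𝔗.length - k) = 0 := by
      intro k
      induction k with
      | zero =>
        intro _
        rw [Nat.sub_zero, partialDegree_length, Nat.div_eq_of_lt a.2]
      | succ k ih =>
        intro hk
        have h1 := ih (by omega)
        have hr : 𝔗.length - (k + 1) < 𝔗.length := by omega
        have h2 := (𝔗.elt_apply_eq_one_iff a ⟨_, hr⟩).1
          (h ⟨_, hr⟩ (by change s ≤ 𝔗.length - (k + 1); omega))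
        rw [digit_eq] at h2
        rw [show 𝔗.length - k = 𝔗.length - (k + 1) + 1 by omega, partialDegree_succ,
          ← Nat.div_div_eq_div_mul] at h1
        have h3 := Nat.div_add_mod ((a : ℕ) / 𝔗.partialDegree (𝔗.length - (k + 1)))
          (𝔗.natEntry (𝔗.length - (k + 1)))
        rw [h1, mul_zero, zero_add] at h3
        exact h3.symm.trans h2
    have := key (𝔗.length - s) le_rfl
    rw [Nat.sub_sub_self hs] at this
    exact (Nat.div_eq_zero_iff_lt (𝔗.partialDegree_pos s)).1 this
  · intro h r hr
    rw [elt_apply_eq_one_iff, digit_eq, Nat.div_eq_of_lt, Nat.zero_mod]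
    exact h.trans_le (Nat.le_of_dvd (𝔗.partialDegree_pos _) (𝔗.partialDegree_dvd hr))

theorem elt_surjective : Function.Surjective 𝔗.elt :=
  ((Nat.bijective_iff_injective_and_card 𝔗.elt).2
    ⟨𝔗.elt_injective, by rw [𝔗.card_group, Nat.card_fin]⟩).2

theorem card_initialSubgroup {s : ℕ} (hs : s ≤ 𝔗.length) :
    Nat.card (𝔗.initialSubgroup s) = 𝔗.partialDegree s := by
  have hle : 𝔗.partialDegree s ≤ 𝔗.degree :=
    Nat.le_of_dvd 𝔗.degree_pos (𝔗.partialDegree_length ▸ 𝔗.partialDegree_dvd hs)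
  have : (𝔗.initialSubgroup s : Set 𝔗.CyclicProd) = Set.range (𝔗.elt ∘ Fin.castLE hle) := by
    ext g
    obtain ⟨a, rfl⟩ := 𝔗.elt_surjective g
    rw [SetLike.mem_coe, elt_mem_initialSubgroup _ hs]
    refine ⟨fun h => ⟨⟨a, h⟩, rfl⟩, ?_⟩
    rintro ⟨b, hb⟩
    rw [← 𝔗.elt_injective hb]
    exact b.2
  change Nat.card ((𝔗.initialSubgroup s : Set 𝔗.CyclicProd)) = _
  rw [this, ← Nat.card_congr (Equiv.ofInjective _
    (𝔗.elt_injective.comp (Fin.castLE_injective hle))), Nat.card_fin]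

theorem initialSubgroup_mono : Monotone 𝔗.initialSubgroup := fun _ _ h _ hg r hr =>
  hg r (h.trans hr)

theorem initialSubgroup_zero : 𝔗.initialSubgroup 0 = ⊥ :=
  (Subgroup.eq_bot_iff_forall _).2 fun _ hg => funext fun r => hg r (Nat.zero_le _)

theorem initialSubgroup_length : 𝔗.initialSubgroup 𝔗.length = ⊤ :=
  top_le_iff.1 fun _ _ r hr => absurd r.2 (not_lt.2 hr)

theorem partialDegree_lt_degree {s : ℕ} (hs : s < 𝔗.length) : 𝔗.partialDegree s < 𝔗.degree :=
  (𝔗.partialDegree_lt_succ hs).trans_le (Nat.le_of_dvd 𝔗.degree_pos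
    (𝔗.partialDegree_dvd_degree hs))

theorem gen_eq_elt (s : Fin 𝔗.length) :
    𝔗.gen s = 𝔗.elt ⟨𝔗.partialDegree s, 𝔗.partialDegree_lt_degree s.2⟩ := by
  funext r
  rcases eq_or_ne r s with rfl | hrs
  · rw [gen, Pi.mulSingle_eq_same, elt_apply, digit_eq, natEntry_of_lt _ r.2]
    simp only
    rw [Nat.div_self (𝔗.partialDegree_pos r), Nat.mod_eq_of_lt (𝔗.one_lt r), Nat.cast_one]
  · rw [gen, Pi.mulSingle_eq_of_ne hrs]
    refine ((𝔗.elt_apply_eq_one_iff _ r).2 ?_).symm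
    rw [digit_eq]
    simp only
    rcases lt_or_gt_of_ne hrs with h | h
    · obtain ⟨c, hc⟩ := 𝔗.partialDegree_dvd (Nat.succ_le_of_lt (Fin.lt_def.1 h))
      rw [hc, Nat.succ_eq_add_one, partialDegree_succ, mul_assoc,
        Nat.mul_div_cancel_left _ (𝔗.partialDegree_pos r), Nat.mul_mod_right]
    · rw [Nat.div_eq_of_lt, Nat.zero_mod]
      exact (𝔗.partialDegree_lt_succ s.2).trans_le (Nat.le_of_dvd (𝔗.partialDegree_pos _)
        (𝔗.partialDegree_dvd (Nat.succ_le_of_lt (Fin.lt_def.1 h))))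

/-- The generator of factor s sits at index n₁⋯n_s (factors counted from 0). Hence F_i contains the
generators of factors 0, …, s and no element outside their product. -/
theorem closure_flag {i : Fin 𝔗.degree} {s : ℕ} (hs : s < 𝔗.length)
    (h1 : 𝔗.partialDegree s ≤ i) (h2 : (i : ℕ) < 𝔗.partialDegree (s + 1)) :
    Subgroup.closure (𝔗.flag.toSet i) = 𝔗.initialSubgroup (s + 1) := by
  refine le_antisymm ((Subgroup.closure_le _).2 ?_) fun g hg => ?_
  · rintro _ ⟨a, ha, rfl⟩
    exact (𝔗.elt_mem_initialSubgroup hs).2 ((Fin.le_def.1 ha).trans_lt h2)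
  · obtain ⟨a, rfl⟩ := 𝔗.elt_surjective g
    refine Subgroup.prod_mem _ fun r _ => ?_
    by_cases hr : s + 1 ≤ r
    · rw [(𝔗.elt_apply_eq_one_iff a r).1 (hg r hr), pow_zero]
      exact one_mem _
    · refine pow_mem (Subgroup.subset_closure ?_) _
      rw [gen_eq_elt]
      refine Set.mem_image_of_mem _ (Fin.le_def.2 (le_trans ?_ h1))
      exact Nat.le_of_dvd (𝔗.partialDegree_pos _) (𝔗.partialDegree_dvd (by omega))

theorem closure_flag_zero {i : Fin 𝔗.degree} (hi : (i : ℕ) = 0) :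
    Subgroup.closure (𝔗.flag.toSet i) = 𝔗.initialSubgroup 0 := by
  rw [𝔗.flag.first i hi, Subgroup.closure_singleton_one, initialSubgroup_zero]

theorem hasTowerType_flag : 𝔗.flag.HasTowerType 𝔗 := by
  refine ⟨fun s => 𝔗.initialSubgroup s, ?_, 𝔗.initialSubgroup_zero, 𝔗.initialSubgroup_length,
    fun A => ⟨?_, ?_⟩, fun s => ?_⟩
  · refine Fin.strictMono_iff_lt_succ.2 fun s => lt_of_le_of_ne
      (𝔗.initialSubgroup_mono (Nat.le_succ _)) fun h => ?_
    have h1 := congrArg (fun H : Subgroup 𝔗.CyclicProd => Nat.card H) h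
    simp only [Fin.val_castSucc, Fin.val_succ] at h1
    rw [card_initialSubgroup _ s.2.le, card_initialSubgroup _ s.2] at h1
    exact (𝔗.partialDegree_lt_succ s.2).ne h1
  · rintro ⟨⟨s, hs⟩, rfl⟩
    cases s with
    | zero => exact ⟨⟨0, 𝔗.degree_pos⟩, 𝔗.closure_flag_zero rfl⟩
    | succ s =>
      have hs' : s < 𝔗.length := Nat.lt_of_succ_lt_succ hs
      exact ⟨⟨𝔗.partialDegree s, 𝔗.partialDegree_lt_degree hs'⟩,
        𝔗.closure_flag hs' le_rfl (𝔗.partialDegree_lt_succ hs')⟩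
  · rintro ⟨i, rfl⟩
    have hex : ∃ k, (i : ℕ) < 𝔗.partialDegree k := ⟨𝔗.length, by
      rw [partialDegree_length]; exact i.2⟩
    -- The least k with i < n₁⋯n_k locates the subgroup generated by F_i.
    classical
    have h1 := Nat.find_spec hex
    have h2 : Nat.find hex ≤ 𝔗.length := Nat.find_min' hex (by
      rw [partialDegree_length]; exact i.2)
    have h3 := fun m => Nat.find_min hex (m := m)
    generalize Nat.find hex = k at h1 h2 h3
    refine ⟨⟨k, Nat.lt_succ_of_le h2⟩, ?_⟩
    cases k with
    | zero =>
      rw [partialDegree_zero, Nat.lt_one_iff] at h1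
      exact (𝔗.closure_flag_zero h1).symm
    | succ k =>
      exact (𝔗.closure_flag h2 (not_lt.1 (h3 k (Nat.lt_succ_self k))) h1).symm
  · simp only [Fin.val_succ, Fin.val_castSucc]
    rw [card_initialSubgroup _ s.2,
      card_initialSubgroup _ s.2.le, partialDegree_succ, natEntry_of_lt _ s.2, mul_comm]

end TowerType

/-! ### The equality of polyhedra -/

theorem mainTheorem12 (𝔗 : TowerType)
    (h : 𝔗.degree < 8 ∨
      (𝔗.degree = 8 ∧ 𝔗.toList ≠ [8]) ∨
      𝔗.degree.Prime ∨
      (∃ p : ℕ, p.Prime ∧ ∀ s, 𝔗.entry s = p) ∨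
      (∃ p : ℕ, p.Prime ∧ 𝔗.toList = [2, p]) ∨
      (∃ p : ℕ, p.Prime ∧ 𝔗.toList = [3, p])) :
    (⋃ (G : Type u) (_ : CommGroup G) (_ : Finite G)
        (F : GroupFlag G 𝔗.degree) (_ : F.HasTowerType 𝔗), polyhedron F.flagType) ∪
      (⋃ (K : Type v) (L : Type w) (_ : Field K) (_ : Field L) (_ : Algebra K L)
        (_ : FiniteDimensional K L)
        (F : FieldFlag K L 𝔗.degree) (_ : F.HasTowerType 𝔗), polyhedron F.flagType) =
    Len 𝔗 := by
  refine Set.Subset.antisymm (Set.union_subset ?_ ?_) ?_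
  · refine Set.iUnion_subset fun G => Set.iUnion_subset fun _ => Set.iUnion_subset fun _ =>
      Set.iUnion_subset fun F => Set.iUnion_subset fun hF => ?_
    obtain ⟨K, L, _, _, _, _, F', hF', heq⟩ := F.exists_fieldFlag hF
    rw [← heq]
    exact TowerType.polyhedron_subset_Len 𝔗 (F'.add_le_flagType hF' h)
  · exact Set.iUnion_subset fun K => Set.iUnion_subset fun L => Set.iUnion_subset fun _ =>
      Set.iUnion_subset fun _ => Set.iUnion_subset fun _ => Set.iUnion_subset fun _ =>
      Set.iUnion_subset fun F => Set.iUnion_subset fun hF =>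
        TowerType.polyhedron_subset_Len 𝔗 (F.add_le_flagType hF h)
  · refine Set.subset_union_of_subset_left ?_ _
    -- A single group flag already realises `Len 𝔗`; the lift only places its group in the required
    -- universe.
    have e : 𝔗.CyclicProd ≃* ULift.{u} 𝔗.CyclicProd := MulEquiv.ulift.symm
    refine Set.subset_iUnion_of_subset (ULift.{u} 𝔗.CyclicProd) ?_
    refine Set.subset_iUnion_of_subset inferInstance ?_
    refine Set.subset_iUnion_of_subset inferInstance ?_
    refine Set.subset_iUnion_of_subset (𝔗.flag.map e) ?_
    refine Set.subset_iUnion_of_subset (𝔗.hasTowerType_flag.map e) ?_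
    rw [GroupFlag.flagType_map]
    exact subset_rfl
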